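/- For $n\ge 1$ let $V$ be a set of $2n$ vertices split into two blocks $V_1,V_2$ of size $n$, and let $G$ be the random graph on $V$ in which the edges are present independently, an edge between two vertices of the same block with probability $a/n$ and an edge between vertices of different blocks with probability $b/n$ (for $n\ge a$). Let $A_0$ be its adjacency matrix and $d:=a+b$. The algorithm **Spectral Partition**, on input $(A_0,d)$, does the following. 1. Zero out all rows and columns of $A_0$ corresponding to vertices of degree bigger than $20d$, to obtain the matrix $A$. 2. Let $W$ be the two-dimensional space spanned by orthonormal eigenvectors of $A$ for its two largest eigenvalues (counted with multiplicity). 3. Let $v_1$ be the orthogonal projection of the all-ones vector onto $W$, and let $v_2$ be a unit vector in $W$ perpendicular to $v_1$. 4. Sort the vertices decreasingly by their values in $v_2$; let $V_1'$ consist of the first $n$ vertices and $V_2'$ of the remaining $n$ vertices. Output $(V_1',V_2')$. Choices left open here ($W$ or $v_2$ if not unique, including the sign of $v_2$, and ties in the sorting) may be made arbitrarily. A partition $\{V_1',V_2'\}$ of $V$ is called $\gamma$-correct if, possibly after exchanging the names $V_1'$ and $V_2'$, $|V_i\cap V_i'|\ge(1-\gamma)n$ for $i=1,2$. **Theorem.**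 There are absolute constants $C_0,C_1>0$ such that the following holds. For any constants $a>b>C_0$ and $\gamma>0$ satisfying $$\frac{(a-b)^2}{a+b}\ \ge\ C_1\,\frac1{\gamma^2},$$ the probability that Spectral Partition outputs a $\gamma$-correct partition, whatever the open choices, tends to $1$ as $n\to\infty$. -/

import Mathlib

noncomputable section

namespace SpectralSBM

/-! ### The two-block stochastic block model -/

/-- The real number `x`, clamped to `[0, 1]`, as a probability. For `x = a / n` the clamping has
no effect as soon as `n ≥ a`. -/
def prob (x : ℝ) : unitInterval := Set.projIcc 0 1 zero_le_one x

open Classical in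
/-- The probability of the potential edge `e`: `a / n` if both endpoints are in the block `V₁` or
both are in its complement, and `b / n` otherwise. -/
def edgeProb (n : ℕ) (a b : ℝ) (V₁ : Finset (Fin (2 * n))) (e : Sym2 (Fin (2 * n))) : unitInterval :=
  if (∀ v ∈ e, v ∈ V₁) ∨ (∀ v ∈ e, v ∉ V₁) then prob (a / n) else prob (b / n)

/-- The graph whose edges are the pairs `e` with `ω e`; the loops are discarded by
`SimpleGraph.fromEdgeSet`. -/
def graphOf {n : ℕ} (ω : Sym2 (Fin (2 * n)) → Prop) : SimpleGraph (Fin (2 * n)) :=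
  SimpleGraph.fromEdgeSet {e | ω e}

/-- The law of the random graph of the stochastic block model on `2 * n` vertices with the blocks
`V₁` and `V₁ᶜ`: the edges are present independently, each with its probability `edgeProb`. -/
def blockModel (n : ℕ) (a b : ℝ) (V₁ : Finset (Fin (2 * n))) :
    MeasureTheory.Measure (SimpleGraph (Fin (2 * n))) :=
  (MeasureTheory.Measure.pi fun e : Sym2 (Fin (2 * n)) =>
    ProbabilityTheory.bernoulliMeasure True False (edgeProb n a b V₁ e)).map graphOf

theorem measurable_graphOf (n : ℕ) : Measurable (graphOf (n := n)) := by
  refine SimpleGraph.measurable_fromEdgeSet.comp ?_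
  exact MeasurableEquiv.setOfPred.measurable

instance (n : ℕ) (a b : ℝ) (V₁ : Finset (Fin (2 * n))) :
    MeasureTheory.IsProbabilityMeasure (blockModel n a b V₁) :=
  MeasureTheory.Measure.isProbabilityMeasure_map (measurable_graphOf n).aemeasurable

open Classical in
/-- The real adjacency matrix of a graph. -/
def adjacency {n : ℕ} (G : SimpleGraph (Fin (2 * n))) :
    Matrix (Fin (2 * n)) (Fin (2 * n)) ℝ :=
  G.adjMatrix ℝ

/-! ### The algorithm -/

open Classical in
/-- The matrix obtained from the adjacency matrix `A₀` by zeroing out all rows and columns of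
vertices whose degree (row sum of `A₀`) is bigger than `20 * d`. -/
def zeroOut {N : ℕ} (A₀ : Matrix (Fin N) (Fin N) ℝ) (d : ℝ) : Matrix (Fin N) (Fin N) ℝ :=
  Matrix.of fun i j =>
    if 20 * d < ∑ k, A₀ i k ∨ 20 * d < ∑ k, A₀ j k then 0 else A₀ i j

/-- `W` is spanned by orthonormal eigenvectors of `A` belonging to its two largest eigenvalues
(counted with multiplicity). If the second and the third eigenvalue coincide, several `W`
qualify. -/
def IsTopTwoEigenspace {N : ℕ} (A : Matrix (Fin N) (Fin N) ℝ)
    (W : Submodule ℝ (EuclideanSpace ℝ (Fin N))) : Prop :=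
  ∃ (lam : Fin N → ℝ) (u : OrthonormalBasis (Fin N) ℝ (EuclideanSpace ℝ (Fin N))),
    Antitone lam ∧ (∀ k, Matrix.toEuclideanLin A (u k) = lam k • u k) ∧
      W = Submodule.span ℝ (u '' {k | (k : ℕ) < 2})

/-- `(S, T)` is a possible output of the algorithm on the input `A₀`, `d`. The choices that the
algorithm leaves open (of the eigenspace and of the vector `v₂` where they are not unique, in
particular of the sign of `v₂`, and of the order among vertices with equal values) are all
allowed. -/
def IsSpectralPartitionOutput (n : ℕ) (A₀ : Matrix (Fin (2 * n)) (Fin (2 * n)) ℝ) (d : ℝ)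
    (S T : Finset (Fin (2 * n))) : Prop :=
  ∃ (W : Submodule ℝ (EuclideanSpace ℝ (Fin (2 * n))))
    (v₁ v₂ : EuclideanSpace ℝ (Fin (2 * n))) (τ : Equiv.Perm (Fin (2 * n))),
    IsTopTwoEigenspace (zeroOut A₀ d) W ∧
    v₁ = W.starProjection (WithLp.toLp 2 fun _ => 1) ∧
    (v₂ ∈ W ∧ ‖v₂‖ = 1 ∧ inner ℝ v₁ v₂ = 0) ∧
    -- `τ k` is the vertex at position `k` when the values of `v₂` are sorted decreasingly
    (∀ k l, k ≤ l → v₂ (τ l) ≤ v₂ (τ k)) ∧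
    S = (Finset.univ.filter fun k : Fin (2 * n) => (k : ℕ) < n).image τ ∧
    T = Sᶜ

/-- The collection `{S, T}` is `γ`-correct for the blocks `V₁`, `V₂` of size `n`, where the names
of the two blocks do not matter. -/
def IsCorrect (n : ℕ) (γ : ℝ) (V₁ V₂ S T : Finset (Fin (2 * n))) : Prop :=
  ((1 - γ) * n ≤ (V₁ ∩ S).card ∧ (1 - γ) * n ≤ (V₂ ∩ T).card) ∨
  ((1 - γ) * n ≤ (V₁ ∩ T).card ∧ (1 - γ) * n ≤ (V₂ ∩ S).card)

/-- The algorithm has an output on the graph `G`, and whatever it outputs is `γ`-correct for the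
blocks `V₁`, `V₁ᶜ`. -/
def SpectralPartitionSucceeds (n : ℕ) (d γ : ℝ) (V₁ : Finset (Fin (2 * n)))
    (G : SimpleGraph (Fin (2 * n))) : Prop :=
  (∃ S T, IsSpectralPartitionOutput n (adjacency G) d S T) ∧
  ∀ S T, IsSpectralPartitionOutput n (adjacency G) d S T → IsCorrect n γ V₁ V₁ᶜ S T

end SpectralSBM

end

/-! Write `d = a + b` and `N = 2n`, and let `σ = ±1` mark the blocks. Apart from its diagonal, the
expected adjacency matrix is `(d 11ᵀ + (a - b) σσᵀ) / N`, which has rank two. If the noise,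
restricted to the vertices of degree at most `20d`, has norm `O(√d)`, then the two top eigenvectors
nearly span `1` and `σ`, so a unit vector of `W` orthogonal to `1` lies close to a multiple of `σ`,
and sorting by it recovers the blocks.

The noise bound is of Kahn–Szemerédi type (`IsRegular.abs_quadForm_trimmedNoise_le`). By rounding,
it suffices to treat lattice vectors `x` in the unit ball, of which there are at most `exp (18 N)`.
Pairs with `|x u * x v| ≤ √d / N` are controlled by a Bernstein bound strong enough for a union
bound over the lattice. Pairs with a larger product are controlled deterministically
(`heavy_sum_le`), from a bound on the number of edges between nested vertex sets and the degree
bound that trimming provides. `IsRegular` collects all random input; it fails with probability at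
most `5 / N`.

The eigenvector step is variational and needs no spectral gap. By Ky Fan's principle, `v₂` and a
unit vector of `W` orthogonal to it do at least as well for the trimmed matrix as `1/√N` and `σ/√N`.
The ideal pair attains `2a - O(√d)`. The companion contributes at most `d + O(√d)`, so `v₂` must
contribute at least `a - b - O(√d)`, which forces correlation with `σ` (`IsRegular.correlation_le`).
A misplaced vertex costs a fixed share of the squared distance from `v₂` to the multiple of `σ`, so
few vertices are misplaced (`card_sub_card_inter_le`). -/

noncomputable section

namespace SpectralSBM

open MeasureTheory ProbabilityTheory Finset

/-! ### Chernoff bounds for independent Bernoulli variables -/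

open Classical in
/-- The real number `1` or `0`, according to whether the proposition holds. -/
def truth (q : Prop) : ℝ := if q then 1 else 0

lemma truth_nonneg (q : Prop) : 0 ≤ truth q := by
  unfold truth; split_ifs <;> norm_num

/-- The law of independent propositions, of which the `i`-th holds with probability `p i`. -/
abbrev indepLaw {ι : Type*} [Fintype ι] (p : ι → unitInterval) : Measure (ι → Prop) :=
  Measure.pi fun i => bernoulliMeasure True False (p i)

/-- Markov's inequality for the exponential moment at parameter `1`; any other parameter can be
absorbed into `c` and `t`. Each factor is `1 + p (exp c - 1) ≤ exp (p (exp c - 1))`. -/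
theorem indepLaw_chernoff {ι : Type*} [Fintype ι] (p : ι → unitInterval) (c : ι → ℝ) (t : ℝ) :
    (indepLaw p).real {ω | t ≤ ∑ i, c i * truth (ω i)} ≤
      Real.exp (-t + ∑ i, (p i : ℝ) * (Real.exp (c i) - 1)) := by
  have hprod : ∀ ω : ι → Prop, Real.exp (1 * ∑ i, c i * truth (ω i)) =
      ∏ i, Real.exp (c i * truth (ω i)) := fun ω => by rw [one_mul, Real.exp_sum]
  have hint : Integrable (fun ω : ι → Prop => Real.exp (1 * ∑ i, c i * truth (ω i)))
      (indepLaw p) := by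
    simp_rw [hprod]
    exact Integrable.fintype_prod (f := fun i (q : Prop) => Real.exp (c i * truth q))
      fun i => integrable_bernoulliMeasure _ _ _ _
  refine (measure_ge_le_exp_mul_mgf t zero_le_one hint).trans ?_
  have hmgf : mgf (fun ω : ι → Prop => ∑ i, c i * truth (ω i)) (indepLaw p) 1 =
      ∏ i, ((p i : ℝ) * Real.exp (c i) + (1 - p i)) := by
    unfold mgf
    simp_rw [hprod]
    rw [integral_fintype_prod_eq_prod (f := fun i (q : Prop) => Real.exp (c i * truth q))]
    refine Finset.prod_congr rfl fun i _ => ?_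
    rw [integral_bernoulliMeasure]
    simp [truth]
  rw [hmgf, Real.exp_add, neg_one_mul]
  gcongr
  rw [Real.exp_sum]
  refine Finset.prod_le_prod (fun i _ => ?_) fun i _ => ?_
  · have h1 := (p i).2.1
    have h2 := (p i).2.2
    have := Real.exp_pos (c i)
    have : 0 ≤ (p i : ℝ) * Real.exp (c i) := by positivity
    linarith
  · have := Real.add_one_le_exp ((p i : ℝ) * (Real.exp (c i) - 1))
    linarith

/-- For `|c| ≤ 1` one has `exp c - 1 - c ≤ c²`; centering removes the linear term. -/
theorem indepLaw_bernstein {ι : Type*} [Fintype ι] (p : ι → unitInterval) (c : ι → ℝ) (t : ℝ)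
    (hc : ∀ i, |c i| ≤ 1) :
    (indepLaw p).real {ω | t ≤ ∑ i, c i * (truth (ω i) - p i)} ≤
      Real.exp (-t + ∑ i, (p i : ℝ) * c i ^ 2) := by
  have h := indepLaw_chernoff p c (t + ∑ i, c i * p i)
  have hset : {ω : ι → Prop | t ≤ ∑ i, c i * (truth (ω i) - p i)} =
      {ω | t + ∑ i, c i * (p i : ℝ) ≤ ∑ i, c i * truth (ω i)} := by
    ext ω
    simp only [Set.mem_ofPred_eq, mul_sub, Finset.sum_sub_distrib, le_sub_iff_add_le]
  rw [hset]
  refine h.trans (Real.exp_le_exp.2 ?_)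
  have : ∑ i, (p i : ℝ) * (Real.exp (c i) - 1) ≤
      ∑ i, ((p i : ℝ) * c i ^ 2 + c i * p i) := by
    refine Finset.sum_le_sum fun i _ => ?_
    have h1 := (abs_le.1 (Real.abs_exp_sub_one_sub_id_le (hc i))).2
    have h2 := (p i).2.1
    nlinarith
  rw [Finset.sum_add_distrib] at this
  linarith

/-! ### Weighted sums over ordered pairs of vertices -/

section Pairs

variable {V : Type*} [DecidableEq V]

/-- The entries of the adjacency matrix of the graph whose edges are the pairs `e` with `ω e`. -/
def edge (ω : Sym2 V → Prop) (u v : V) : ℝ := if u = v then 0 else truth (ω s(u, v))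

/-- The expectation of `edge`. -/
def meanEdge (p : Sym2 V → unitInterval) (u v : V) : ℝ := if u = v then 0 else (p s(u, v) : ℝ)

lemma edge_nonneg (ω : Sym2 V → Prop) (u v : V) : 0 ≤ edge ω u v := by
  unfold edge; split_ifs
  exacts [le_rfl, truth_nonneg _]

lemma edge_comm (ω : Sym2 V → Prop) (u v : V) : edge ω u v = edge ω v u := by
  unfold edge; simp only [eq_comm, Sym2.eq_swap]

lemma meanEdge_nonneg (p : Sym2 V → unitInterval) (u v : V) : 0 ≤ meanEdge p u v := by
  unfold meanEdge; split_ifs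
  exacts [le_rfl, (p _).2.1]

variable [Fintype V]

/-- The ordered pairs with different entries that form the unordered pair `e`. -/
def orderings (e : Sym2 V) : Finset (V × V) := univ.filter fun z => z.1 ≠ z.2 ∧ s(z.1, z.2) = e

lemma card_orderings_le (e : Sym2 V) : #(orderings e) ≤ 2 := by
  induction e using Sym2.ind with
  | _ x y =>
    refine (card_le_card (t := {(x, y), (y, x)}) ?_).trans card_le_two
    rintro ⟨u, v⟩ h
    simp only [orderings, mem_filter, mem_univ, true_and, Sym2.eq_iff] at h
    simp only [mem_insert, mem_singleton, Prod.mk.injEq]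
    exact h.2

/-- The entries at `(u, v)` and `(v, u)` are the same random variable. Grouping by unordered pairs
turns the double sum into a sum of independent terms. -/
lemma sum_offDiag_eq_sum_sym2 (w : V → V → ℝ) (f : Sym2 V → ℝ) :
    ∑ u, ∑ v, w u v * (if u = v then 0 else f s(u, v)) =
      ∑ e, (∑ z ∈ orderings e, w z.1 z.2) * f e := by
  rw [← Fintype.sum_prod_type' (f := fun u v => w u v * (if u = v then 0 else f s(u, v)))]
  rw [← Finset.sum_fiberwise_of_maps_to (s := univ) (t := univ)
    (g := fun z : V × V => s(z.1, z.2)) fun _ _ => mem_univ _]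
  refine Finset.sum_congr rfl fun e _ => ?_
  rw [Finset.sum_mul, orderings]
  rw [← Finset.sum_filter_add_sum_filter_not (univ.filter fun z : V × V => s(z.1, z.2) = e)
    (fun z => z.1 ≠ z.2), Finset.filter_filter, Finset.filter_filter]
  have h0 : ∑ z ∈ univ.filter (fun z : V × V => s(z.1, z.2) = e ∧ ¬ z.1 ≠ z.2),
      w z.1 z.2 * (if z.1 = z.2 then 0 else f s(z.1, z.2)) = 0 := by
    refine Finset.sum_eq_zero fun z hz => ?_
    simp only [mem_filter, not_not] at hz
    simp [hz.2.2]
  rw [h0, add_zero]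
  refine Finset.sum_congr (by ext; simp [and_comm]) fun z hz => ?_
  simp only [mem_filter, mem_univ, true_and] at hz
  rw [if_neg (by tauto)]
  rcases hz with ⟨h1, h2⟩
  first | rw [h1] | rw [h2]

/-- An unordered pair collects at most two weights. So weights up to `1/2` keep its coefficient
within `1`, and its square is at most twice the sum of the squared weights. -/
theorem pairs_bernstein (p : Sym2 V → unitInterval) {q : ℝ} (hq : ∀ e, (p e : ℝ) ≤ q)
    (w : V → V → ℝ) (hw : ∀ u v, |w u v| ≤ 1 / 2) (t : ℝ) :
    (indepLaw p).real {ω | t ≤ ∑ u, ∑ v, w u v * (edge ω u v - meanEdge p u v)} ≤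
      Real.exp (-t + 2 * q * ∑ u, ∑ v, w u v ^ 2) := by
  set c : Sym2 V → ℝ := fun e => ∑ z ∈ orderings e, w z.1 z.2 with hcdef
  have hc : ∀ e, |c e| ≤ 1 := fun e => by
    calc |c e| ≤ ∑ z ∈ orderings e, |w z.1 z.2| := abs_sum_le_sum_abs _ _
      _ ≤ ∑ z ∈ orderings e, (1 / 2 : ℝ) := sum_le_sum fun z _ => hw _ _
      _ = #(orderings e) * (1 / 2 : ℝ) := by rw [sum_const, nsmul_eq_mul]
      _ ≤ 2 * (1 / 2 : ℝ) := by gcongr; exact_mod_cast card_orderings_le e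
      _ = 1 := by norm_num
  have hset : {ω : Sym2 V → Prop | t ≤ ∑ u, ∑ v, w u v * (edge ω u v - meanEdge p u v)} =
      {ω | t ≤ ∑ e, c e * (truth (ω e) - p e)} := by
    ext ω
    simp only [Set.mem_ofPred_eq]
    rw [hcdef, ← sum_offDiag_eq_sum_sym2 w fun e => truth (ω e) - (p e : ℝ)]
    have : ∀ u v : V, edge ω u v - meanEdge p u v =
        if u = v then 0 else truth (ω s(u, v)) - (p s(u, v) : ℝ) := fun u v => by
      unfold edge meanEdge; split_ifs <;> simp
    simp_rw [this]
  rw [hset]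
  refine (indepLaw_bernstein p c t hc).trans (Real.exp_le_exp.2 ?_)
  have hq0 : 0 ≤ q ∨ IsEmpty (Sym2 V) := by
    rcases isEmpty_or_nonempty (Sym2 V) with h | ⟨⟨e⟩⟩
    · exact Or.inr h
    · exact Or.inl ((p e).2.1.trans (hq e))
  rcases hq0 with hq0 | hq0
  swap
  · have : IsEmpty V := ⟨fun v => hq0.false s(v, v)⟩
    simp
  have h1 : ∑ e, c e ^ 2 ≤ 2 * ∑ u, ∑ v, w u v ^ 2 := by
    have h2 : ∀ e, c e ^ 2 ≤ 2 * ∑ z ∈ orderings e, w z.1 z.2 ^ 2 := fun e => by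
      refine (sq_sum_le_card_mul_sum_sq (s := orderings e) (f := fun z => w z.1 z.2)).trans ?_
      gcongr
      exact_mod_cast card_orderings_le e
    calc ∑ e, c e ^ 2 ≤ ∑ e, 2 * ∑ z ∈ orderings e, w z.1 z.2 ^ 2 := sum_le_sum fun e _ => h2 e
      _ = 2 * ∑ e, (∑ z ∈ orderings e, w z.1 z.2 ^ 2) * 1 := by simp only [mul_sum, mul_one]
      _ = 2 * ∑ u, ∑ v, w u v ^ 2 * (if u = v then 0 else 1) := by
        rw [← sum_offDiag_eq_sum_sym2 (fun u v => w u v ^ 2) fun _ => 1]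
      _ ≤ 2 * ∑ u, ∑ v, w u v ^ 2 := by
        gcongr with u _ v _
        split_ifs
        · simpa using sq_nonneg (w u v)
        · simp
  have h3 : ∑ e, (p e : ℝ) * c e ^ 2 ≤ q * ∑ e, c e ^ 2 := by
    rw [mul_sum]
    exact sum_le_sum fun e _ => mul_le_mul_of_nonneg_right (hq e) (sq_nonneg _)
  nlinarith

/-- The threshold is `2k` because an edge inside `S ∩ T` is counted in both orders. The parameter
`θ` stays free: sparse pairs of sets need a large one. -/
theorem edgeCount_chernoff (p : Sym2 V → unitInterval) {q : ℝ} (hq : ∀ e, (p e : ℝ) ≤ q)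
    (hq0 : 0 ≤ q) (S T : Finset V) {θ : ℝ} (hθ : 0 ≤ θ) (k : ℝ) :
    (indepLaw p).real {ω | 2 * k ≤ ∑ u ∈ S, ∑ v ∈ T, edge ω u v} ≤
      Real.exp (-(θ * k) + q * (#S * #T) * Real.exp θ) := by
  set F : Finset (Sym2 V) := (S ×ˢ T).image fun z => s(z.1, z.2)
  have hF : (#F : ℝ) ≤ #S * #T := by
    have : #F ≤ #S * #T := card_image_le.trans (card_product _ _).le
    exact_mod_cast this
  have hsub : {ω : Sym2 V → Prop | 2 * k ≤ ∑ u ∈ S, ∑ v ∈ T, edge ω u v} ⊆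
      {ω | θ * k ≤ ∑ e, (if e ∈ F then θ else 0) * truth (ω e)} := by
    intro ω hω
    simp only [Set.mem_ofPred_eq] at hω ⊢
    have h1 : ∑ u ∈ S, ∑ v ∈ T, edge ω u v ≤ 2 * ∑ e ∈ F, truth (ω e) := by
      have : ∑ u ∈ S, ∑ v ∈ T, edge ω u v =
          ∑ u, ∑ v, (if u ∈ S ∧ v ∈ T then (1 : ℝ) else 0) *
            (if u = v then 0 else truth (ω s(u, v))) := by
        have hrow : ∀ u, ∑ v, (if u ∈ S ∧ v ∈ T then (1 : ℝ) else 0) *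
            (if u = v then 0 else truth (ω s(u, v))) =
            if u ∈ S then ∑ v ∈ T, edge ω u v else 0 := fun u => by
          by_cases hu : u ∈ S <;> simp only [hu, true_and, false_and, if_true, if_false, ite_mul,
            one_mul, zero_mul, sum_const_zero, edge, sum_ite_mem, univ_inter]
        simp only [hrow, sum_ite_mem, univ_inter]
      rw [this, sum_offDiag_eq_sum_sym2 (fun u v => if u ∈ S ∧ v ∈ T then (1 : ℝ) else 0)
        fun e => truth (ω e), mul_sum, ← Finset.sum_subset (subset_univ F)]
      · refine sum_le_sum fun e _ => ?_
        gcongr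
        · exact truth_nonneg _
        calc ∑ z ∈ orderings e, (if z.1 ∈ S ∧ z.2 ∈ T then (1 : ℝ) else 0)
            ≤ ∑ z ∈ orderings e, 1 := sum_le_sum fun z _ => by split_ifs <;> norm_num
          _ = #(orderings e) := by simp
          _ ≤ 2 := by exact_mod_cast card_orderings_le e
      · intro e _ he
        rw [Finset.sum_eq_zero, zero_mul]
        intro z hz
        rw [if_neg]
        rintro ⟨hz1, hz2⟩
        simp only [orderings, mem_filter] at hz
        exact he (mem_image.2 ⟨z, mem_product.2 ⟨hz1, hz2⟩, hz.2.2⟩)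
    have h2 : ∑ e, (if e ∈ F then θ else 0) * truth (ω e) = θ * ∑ e ∈ F, truth (ω e) := by
      simp [ite_mul, mul_sum]
    rw [h2]
    exact mul_le_mul_of_nonneg_left (by linarith) hθ
  refine (measureReal_mono hsub).trans ((indepLaw_chernoff p _ _).trans (Real.exp_le_exp.2 ?_))
  gcongr
  calc ∑ e, (p e : ℝ) * (Real.exp (if e ∈ F then θ else 0) - 1)
      ≤ ∑ e, if e ∈ F then q * Real.exp θ else 0 := by
        refine sum_le_sum fun e _ => ?_
        split_ifs
        · exact mul_le_mul (hq e) (by linarith) (by simpa using hθ) hq0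
        · simp
    _ = #F * (q * Real.exp θ) := by simp
    _ ≤ (#S * #T) * (q * Real.exp θ) := by gcongr
    _ = q * (#S * #T) * Real.exp θ := by ring

end Pairs

/-! ### Regularity properties that hold with high probability -/

section Counting

lemma sum_Icc_half_pow_natAbs (R : ℕ) :
    ∑ k ∈ Icc (-(R : ℤ)) R, (1 / 2 : ℝ) ^ k.natAbs = 3 - 2 * (1 / 2) ^ R := by
  induction R with
  | zero => norm_num
  | succ R ih =>
    have h : Icc (-((R + 1 : ℕ) : ℤ)) ((R + 1 : ℕ) : ℤ) =
        insert ((R + 1 : ℕ) : ℤ) (insert (-((R + 1 : ℕ) : ℤ)) (Icc (-(R : ℤ)) R)) := by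
      ext k; simp only [mem_Icc, mem_insert]; push_cast; omega
    rw [h, sum_insert, sum_insert, ih, Int.natAbs_neg, Int.natAbs_natCast]
    · ring
    · simp
    · simp only [mem_insert, mem_Icc]; push_cast; omega

lemma sum_exp_neg_sq_le (R : ℕ) :
    ∑ k ∈ Icc (-(R : ℤ)) R, Real.exp (-(k : ℝ) ^ 2) ≤ Real.exp 2 := by
  have h1 : ∀ k : ℤ, Real.exp (-(k : ℝ) ^ 2) ≤ (1 / 2 : ℝ) ^ k.natAbs := fun k => by
    have h2 : ((k.natAbs : ℕ) : ℝ) ≤ (k : ℝ) ^ 2 := by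
      have : (k.natAbs : ℤ) ≤ k ^ 2 := by
        rw [← Int.natAbs_sq, sq]
        have : k.natAbs ≤ k.natAbs * k.natAbs := Nat.le_mul_self _
        exact_mod_cast this
      calc ((k.natAbs : ℕ) : ℝ) = ((k.natAbs : ℤ) : ℝ) := (Int.cast_natCast _).symm
        _ ≤ ((k ^ 2 : ℤ) : ℝ) := Int.cast_le.2 this
        _ = (k : ℝ) ^ 2 := by push_cast; rfl
    calc Real.exp (-(k : ℝ) ^ 2) ≤ Real.exp (-(k.natAbs : ℝ)) := by gcongr
      _ = Real.exp (-1) ^ k.natAbs := by rw [← Real.exp_nat_mul]; ring_nf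
      _ ≤ (1 / 2 : ℝ) ^ k.natAbs := by
        gcongr
        rw [Real.exp_neg, one_div]
        gcongr
        have := Real.add_one_le_exp 1
        linarith
  calc ∑ k ∈ Icc (-(R : ℤ)) R, Real.exp (-(k : ℝ) ^ 2)
      ≤ ∑ k ∈ Icc (-(R : ℤ)) R, (1 / 2 : ℝ) ^ k.natAbs := sum_le_sum fun k _ => h1 k
    _ = 3 - 2 * (1 / 2) ^ R := sum_Icc_half_pow_natAbs R
    _ ≤ 3 := by have : (0 : ℝ) ≤ (1 / 2) ^ R := by positivity
                linarith
    _ ≤ Real.exp 2 := by have := Real.add_one_le_exp 2; linarith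

variable (V : Type*) [Fintype V] [DecidableEq V]

open Classical in
/-- The integer vectors of squared norm at most `16 * card V`. -/
def latticeBall : Finset (V → ℤ) :=
  (Fintype.piFinset fun _ => Icc (-((16 * Fintype.card V : ℕ) : ℤ)) (16 * Fintype.card V : ℕ)).filter
    fun z => ∑ u, (z u : ℝ) ^ 2 ≤ 16 * Fintype.card V

variable {V} in
lemma mem_latticeBall {z : V → ℤ} :
    z ∈ latticeBall V ↔ ∑ u, (z u : ℝ) ^ 2 ≤ 16 * Fintype.card V := by
  simp only [latticeBall, mem_filter, Fintype.mem_piFinset, mem_Icc, and_iff_right_iff_imp]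
  intro h u
  have h1 : (z u : ℝ) ^ 2 ≤ 16 * Fintype.card V :=
    (single_le_sum (f := fun u => (z u : ℝ) ^ 2) (fun _ _ => sq_nonneg _) (mem_univ u)).trans h
  have h2 : z u ^ 2 ≤ ((16 * Fintype.card V : ℕ) : ℤ) := by exact_mod_cast h1
  have h3 := Int.le_self_sq (z u)
  have h4 := Int.le_self_sq (-z u)
  rw [neg_sq] at h4
  omega

/-- Give each integer vector the weight `exp (16 N - |z|²)`, which is at least `1` on the ball. The
total weight factors over coordinates, each factor being at most `exp 2`. -/
lemma card_latticeBall_le : (#(latticeBall V) : ℝ) ≤ Real.exp (18 * Fintype.card V) := by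
  classical
  set R := 16 * Fintype.card V
  calc (#(latticeBall V) : ℝ) = ∑ z ∈ latticeBall V, 1 := by simp
    _ ≤ ∑ z ∈ latticeBall V, Real.exp (16 * Fintype.card V) * ∏ u, Real.exp (-(z u : ℝ) ^ 2) := by
      refine sum_le_sum fun z hz => ?_
      rw [mem_latticeBall] at hz
      rw [← Real.exp_sum, ← Real.exp_add]
      refine Real.one_le_exp ?_
      rw [sum_neg_distrib]
      linarith
    _ ≤ ∑ z ∈ Fintype.piFinset fun _ : V => Icc (-(R : ℤ)) R,
        Real.exp (16 * Fintype.card V) * ∏ u, Real.exp (-(z u : ℝ) ^ 2) :=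
      sum_le_sum_of_subset_of_nonneg (filter_subset _ _) fun _ _ _ => by positivity
    _ = Real.exp (16 * Fintype.card V) *
        ∏ _u : V, ∑ k ∈ Icc (-(R : ℤ)) R, Real.exp (-(k : ℝ) ^ 2) := by
      rw [← mul_sum, prod_univ_sum]
    _ ≤ Real.exp (16 * Fintype.card V) * ∏ _u : V, Real.exp 2 := by
      gcongr
      exact sum_exp_neg_sq_le R
    _ = Real.exp (18 * Fintype.card V) := by
      rw [prod_const, card_univ, ← Real.exp_nat_mul, ← Real.exp_add]
      ring_nf

lemma choose_le_exp_mul_log {n t : ℕ} (ht : 0 < t) (hn : 0 < n) :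
    (n.choose t : ℝ) ≤ Real.exp (t * (1 + Real.log (n / t))) := by
  have h0 : (0 : ℝ) < t := by exact_mod_cast ht
  have h0' : (0 : ℝ) < n := by exact_mod_cast hn
  have h1 : (n.choose t : ℝ) ≤ (n : ℝ) ^ t / t.factorial := Nat.choose_le_pow_div t n
  have h2 := Real.pow_div_factorial_le_exp (t : ℝ) h0.le t
  calc (n.choose t : ℝ) ≤ (n : ℝ) ^ t / t.factorial := h1
    _ = (n / t : ℝ) ^ t * ((t : ℝ) ^ t / t.factorial) := by
      rw [div_pow]; field_simp
    _ ≤ (n / t : ℝ) ^ t * Real.exp t := by gcongr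
    _ = Real.exp (t * (1 + Real.log (n / t))) := by
      rw [mul_add, mul_one, Real.exp_add, Real.exp_nat_mul, Real.exp_log (by positivity), mul_comm]

/-- In the union bound over vertex sets, this makes even the smallest sets pay a power of `n`. -/
lemma one_add_log_le_mul_one_add_log_div {n t : ℕ} (ht : 0 < t) (htn : t ≤ n) :
    1 + Real.log n ≤ t * (1 + Real.log (n / t)) := by
  have h0 : (1 : ℝ) ≤ t := by exact_mod_cast ht
  have h1 : (t : ℝ) ≤ n := by exact_mod_cast htn
  have h2 : 0 ≤ Real.log (n / t) := Real.log_nonneg ((one_le_div (by linarith)).2 h1)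
  have h3 : Real.log (n / t) = Real.log n - Real.log t := Real.log_div (by linarith) (by linarith)
  have h4 := Real.log_le_sub_one_of_pos (x := t) (by linarith)
  nlinarith

end Counting

/-! ### Probabilities of the regularity properties -/

section Regularity

variable {V : Type*} [Fintype V] [DecidableEq V]

/-- The part of the quadratic form of the centered adjacency matrix that comes from the pairs with
a small product `x u * x v`. -/
def lightForm (d : ℝ) (p : Sym2 V → unitInterval) (ω : Sym2 V → Prop) (x : V → ℝ) : ℝ :=
  ∑ u, ∑ v, (if |x u * x v| ≤ √d / Fintype.card V then x u * x v else 0) *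
    (edge ω u v - meanEdge p u v)

/-- The lattice vector `z`, scaled such that `latticeBall` goes to the unit ball. -/
def scaled (z : V → ℤ) (u : V) : ℝ := z u / (4 * √(Fintype.card V))

/-- The regularity properties of a sparse random graph with edge probabilities `p` on which the
analysis of the spectral algorithm is based. -/
structure IsRegular (d : ℝ) (p : Sym2 V → unitInterval) (B : Finset V) (ω : Sym2 V → Prop) :
    Prop where
  light : ∀ z ∈ latticeBall V, |lightForm d p ω (scaled z)| ≤ 40 * √d
  degrees : ∀ S : Finset V,
    ∑ u ∈ S, ∑ v, (edge ω u v - meanEdge p u v) ≤ 6 * √d * Fintype.card V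
  block : -(4 * √d * Fintype.card V) ≤
    ∑ u, ∑ v, (if (u ∈ B ↔ v ∈ B) then 1 else 0) * (edge ω u v - meanEdge p u v)
  -- Nested sets suffice, because the bound is only applied to superlevel sets of one function.
  discrepancy : ∀ S T : Finset V, S ⊆ T → S.Nonempty →
    ∑ u ∈ S, ∑ v ∈ T, edge ω u v ≤ 12 * d * #S * #T / Fintype.card V +
      12 * #T * (1 + Real.log (Fintype.card V / #T)) /
        Real.log (Real.exp 1 + Fintype.card V / (d * #S))

variable {d : ℝ} {p : Sym2 V → unitInterval}

/-- Dividing by `2√d` brings the weights below `1/2`. With `q = 2d/N` the variance term becomes `∑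
w² / N ≤ N`, independent of `d`. -/
theorem weighted_bernstein [Nonempty V] (hd : 0 < d)
    (hp : ∀ e, (p e : ℝ) ≤ 2 * d / Fintype.card V) (w : V → V → ℝ)
    (hw : ∀ u v, |w u v| ≤ √d) (hw2 : ∑ u, ∑ v, w u v ^ 2 ≤ Fintype.card V ^ 2) (t : ℝ) :
    (indepLaw p).real {ω | t * √d ≤ ∑ u, ∑ v, w u v * (edge ω u v - meanEdge p u v)} ≤
      Real.exp (-(t / 2) + Fintype.card V) := by
  have hs : 0 < √d := Real.sqrt_pos.2 hd
  have hss : √d ^ 2 = d := Real.sq_sqrt hd.le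
  have hN : (0 : ℝ) < Fintype.card V := by exact_mod_cast Fintype.card_pos
  have h := pairs_bernstein p hp (fun u v => w u v / (2 * √d)) (fun u v => by
    rw [abs_div, abs_of_pos (by positivity : 0 < 2 * √d), div_le_iff₀ (by positivity)]
    linarith [hw u v]) (t / 2)
  have hset : {ω : Sym2 V → Prop | t * √d ≤
      ∑ u, ∑ v, w u v * (edge ω u v - meanEdge p u v)} =
      {ω | t / 2 ≤ ∑ u, ∑ v, w u v / (2 * √d) * (edge ω u v - meanEdge p u v)} := by
    ext ω
    have : ∑ u, ∑ v, w u v / (2 * √d) * (edge ω u v - meanEdge p u v) =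
        (∑ u, ∑ v, w u v * (edge ω u v - meanEdge p u v)) / (2 * √d) := by
      simp only [sum_div]
      exact sum_congr rfl fun u _ => sum_congr rfl fun v _ => by ring
    simp only [Set.mem_ofPred_eq]
    rw [this, le_div_iff₀ (by positivity)]
    constructor <;> intro h <;> linarith
  rw [hset]
  refine h.trans (Real.exp_le_exp.2 ?_)
  have h2 : ∑ u, ∑ v, (w u v / (2 * √d)) ^ 2 = (∑ u, ∑ v, w u v ^ 2) / (4 * d) := by
    simp only [sum_div]
    exact sum_congr rfl fun u _ => sum_congr rfl fun v _ => by rw [div_pow, mul_pow, hss]; ring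
  rw [h2]
  have h3 : 2 * (2 * d / Fintype.card V) * ((∑ u, ∑ v, w u v ^ 2) / (4 * d)) =
      (∑ u, ∑ v, w u v ^ 2) / Fintype.card V := by field_simp; ring
  rw [h3]
  have h4 : (∑ u, ∑ v, w u v ^ 2) / (Fintype.card V : ℝ) ≤ Fintype.card V := by
    rw [div_le_iff₀ hN]; nlinarith
  linarith

omit [DecidableEq V] in
lemma sum_scaled_sq [Nonempty V] (z : V → ℤ) :
    ∑ u, scaled z u ^ 2 = (∑ u, (z u : ℝ) ^ 2) / (16 * Fintype.card V) := by
  have hN : (0 : ℝ) ≤ Fintype.card V := by positivity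
  rw [sum_div]
  refine sum_congr rfl fun u _ => ?_
  rw [scaled, div_pow, mul_pow, Real.sq_sqrt hN]
  norm_num

lemma sum_scaled_sq_le_one [Nonempty V] {z : V → ℤ} (hz : z ∈ latticeBall V) :
    ∑ u, scaled z u ^ 2 ≤ 1 := by
  have hN : (0 : ℝ) < Fintype.card V := by exact_mod_cast Fintype.card_pos
  rw [sum_scaled_sq, div_le_one (by positivity)]
  exact mem_latticeBall.1 hz

/-- On light pairs `N * x u * x v` is at most `√d` in absolute value, so the Bernstein bound applies
at level `40 N` and gives `exp (-19 N)`. This beats the `exp (18 N)` lattice vectors. -/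
theorem measure_not_light_le [Nonempty V] (hd : 0 < d)
    (hp : ∀ e, (p e : ℝ) ≤ 2 * d / Fintype.card V) :
    (indepLaw p).real {ω | ¬ ∀ z ∈ latticeBall V, |lightForm d p ω (scaled z)| ≤ 40 * √d} ≤
      2 * Real.exp (-Fintype.card V) := by
  have hs : 0 < √d := Real.sqrt_pos.2 hd
  have hss : √d ^ 2 = d := Real.sq_sqrt hd.le
  have hN : (0 : ℝ) < Fintype.card V := by exact_mod_cast Fintype.card_pos
  set N : ℝ := ((Fintype.card V : ℕ) : ℝ) with hNdef
  have key : ∀ z ∈ latticeBall V, ∀ ε : ℝ, |ε| = 1 →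
      (indepLaw p).real {ω | 40 * √d ≤ ε * lightForm d p ω (scaled z)} ≤ Real.exp (-19 * N) := by
    intro z hz ε hε
    set x := scaled z
    have hx : ∑ u, x u ^ 2 ≤ 1 := sum_scaled_sq_le_one hz
    have hε2 : ε ^ 2 = 1 := by rw [← sq_abs, hε, one_pow]
    have h := weighted_bernstein hd hp
      (fun u v => ε * N * (if |x u * x v| ≤ √d / N then x u * x v else 0)) (fun u v => by
        rw [abs_mul, abs_mul, hε, one_mul, abs_of_pos hN]
        split_ifs with h
        · rwa [mul_comm, ← le_div_iff₀ hN]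
        · simp) (by
        have : ∑ u, ∑ v, (ε * N * (if |x u * x v| ≤ √d / N then x u * x v else 0)) ^ 2 ≤
            ∑ u, ∑ v, N ^ 2 * (x u ^ 2 * x v ^ 2) := by
          refine sum_le_sum fun u _ => sum_le_sum fun v _ => ?_
          rw [mul_pow, mul_pow, hε2, one_mul]
          gcongr
          split_ifs
          · rw [mul_pow]
          · rw [zero_pow two_ne_zero]; positivity
        refine this.trans ?_
        simp only [← mul_sum, ← sum_mul]
        have h0 : 0 ≤ ∑ u, x u ^ 2 := sum_nonneg fun _ _ => sq_nonneg _
        have : (∑ u, x u ^ 2) * ∑ v, x v ^ 2 ≤ 1 := by nlinarith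
        nlinarith [sq_nonneg N]) (40 * N)
    have hset : {ω : Sym2 V → Prop | 40 * √d ≤ ε * lightForm d p ω x} =
        {ω | 40 * N * √d ≤ ∑ u, ∑ v,
          ε * N * (if |x u * x v| ≤ √d / N then x u * x v else 0) *
            (edge ω u v - meanEdge p u v)} := by
      ext ω
      have : ∑ u, ∑ v, ε * N * (if |x u * x v| ≤ √d / N then x u * x v else 0) *
            (edge ω u v - meanEdge p u v) = N * (ε * lightForm d p ω x) := by
        simp only [lightForm, mul_sum]
        exact sum_congr rfl fun u _ => sum_congr rfl fun v _ => by ring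
      simp only [Set.mem_ofPred_eq]
      rw [this]
      constructor
      · intro h; nlinarith
      · intro h
        refine le_of_mul_le_mul_left ?_ hN
        linarith
    rw [hset]
    refine h.trans (Real.exp_le_exp.2 ?_)
    linarith
  have hsub : {ω : Sym2 V → Prop | ¬ ∀ z ∈ latticeBall V,
      |lightForm d p ω (scaled z)| ≤ 40 * √d} ⊆
      ⋃ z ∈ latticeBall V, ({ω | 40 * √d ≤ 1 * lightForm d p ω (scaled z)} ∪
        {ω | 40 * √d ≤ -1 * lightForm d p ω (scaled z)}) := by
    intro ω hω
    simp only [Set.mem_ofPred_eq, not_forall, not_le] at hω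
    obtain ⟨z, hz, h⟩ := hω
    simp only [Set.mem_iUnion]
    refine ⟨z, hz, ?_⟩
    rcases lt_abs.1 h with h | h
    · left; simpa using h.le
    · right; simpa using h.le
  calc _ ≤ (indepLaw p).real _ := measureReal_mono hsub (measure_ne_top _ _)
    _ ≤ ∑ z ∈ latticeBall V, (indepLaw p).real
        ({ω | 40 * √d ≤ 1 * lightForm d p ω (scaled z)} ∪
        {ω | 40 * √d ≤ -1 * lightForm d p ω (scaled z)}) := measureReal_biUnion_finset_le _ _
    _ ≤ ∑ z ∈ latticeBall V, 2 * Real.exp (-19 * N) := by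
      refine sum_le_sum fun z hz => (measureReal_union_le _ _).trans ?_
      rw [two_mul]
      exact add_le_add (key z hz 1 (by simp)) (key z hz (-1) (by simp))
    _ = #(latticeBall V) * (2 * Real.exp (-19 * N)) := by rw [sum_const, nsmul_eq_mul]
    _ ≤ Real.exp (18 * N) * (2 * Real.exp (-19 * N)) := by
      gcongr
      exact card_latticeBall_le V
    _ = 2 * Real.exp (-N) := by
      rw [mul_left_comm, ← Real.exp_add]; ring_nf

/-- Each set fails with probability at most `exp (-2 N)`, and there are `2 ^ N ≤ exp N` sets. -/
theorem measure_not_degrees_le [Nonempty V] (hd : 1 ≤ d)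
    (hp : ∀ e, (p e : ℝ) ≤ 2 * d / Fintype.card V) :
    (indepLaw p).real {ω | ¬ ∀ S : Finset V,
      ∑ u ∈ S, ∑ v, (edge ω u v - meanEdge p u v) ≤ 6 * √d * Fintype.card V} ≤
      Real.exp (-Fintype.card V) := by
  have hs : 1 ≤ √d := Real.one_le_sqrt.2 hd
  set N : ℝ := ((Fintype.card V : ℕ) : ℝ) with hNdef
  have hsub : {ω : Sym2 V → Prop | ¬ ∀ S : Finset V,
      ∑ u ∈ S, ∑ v, (edge ω u v - meanEdge p u v) ≤ 6 * √d * N} ⊆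
      ⋃ S ∈ (univ : Finset (Finset V)), {ω | 6 * N * √d ≤
        ∑ u, ∑ v, (if u ∈ S then 1 else 0) * (edge ω u v - meanEdge p u v)} := by
    intro ω hω
    simp only [Set.mem_ofPred_eq, not_forall, not_le] at hω
    obtain ⟨S, h⟩ := hω
    simp only [Set.mem_iUnion]
    refine ⟨S, mem_univ _, ?_⟩
    simp only [Set.mem_ofPred_eq, ← mul_sum]
    simp only [ite_mul, one_mul, zero_mul, sum_ite_mem, univ_inter]
    linarith
  calc _ ≤ (indepLaw p).real _ := measureReal_mono hsub (measure_ne_top _ _)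
    _ ≤ ∑ S ∈ (univ : Finset (Finset V)), (indepLaw p).real _ := measureReal_biUnion_finset_le _ _
    _ ≤ ∑ S ∈ (univ : Finset (Finset V)), Real.exp (-(6 * N / 2) + N) := by
      refine sum_le_sum fun S _ => weighted_bernstein (by linarith) hp
        (fun u v => if u ∈ S then 1 else 0) (fun u v => ?_) ?_ (6 * N)
      · split_ifs <;> norm_num
        exact hd
      · calc ∑ u : V, ∑ v : V, (if u ∈ S then (1 : ℝ) else 0) ^ 2 ≤ ∑ u : V, ∑ v : V, 1 :=
              sum_le_sum fun u _ => sum_le_sum fun v _ => by split_ifs <;> norm_num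
          _ = (Fintype.card V : ℝ) ^ 2 := by simp [sq]
    _ = 2 ^ Fintype.card V * Real.exp (-2 * N) := by
      simp only [sum_const, card_univ, Fintype.card_finset, nsmul_eq_mul]
      push_cast
      ring_nf
    _ ≤ Real.exp 1 ^ Fintype.card V * Real.exp (-2 * N) := by
      gcongr
      have := Real.add_one_le_exp 1
      linarith
    _ = Real.exp (-N) := by
      rw [← Real.exp_nat_mul, ← Real.exp_add, ← hNdef]; ring_nf

theorem measure_not_block_le [Nonempty V] (hd : 1 ≤ d)
    (hp : ∀ e, (p e : ℝ) ≤ 2 * d / Fintype.card V) (B : Finset V) :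
    (indepLaw p).real {ω | ¬ -(4 * √d * Fintype.card V) ≤
      ∑ u, ∑ v, (if (u ∈ B ↔ v ∈ B) then 1 else 0) * (edge ω u v - meanEdge p u v)} ≤
      Real.exp (-Fintype.card V) := by
  have hs : 1 ≤ √d := Real.one_le_sqrt.2 hd
  set N : ℝ := ((Fintype.card V : ℕ) : ℝ) with hNdef
  have h := weighted_bernstein (by linarith) hp
    (fun u v => -(if (u ∈ B ↔ v ∈ B) then 1 else 0)) (fun u v => by
      split_ifs <;> norm_num
      exact hd) (by
      calc ∑ u : V, ∑ v : V, (-(if (u ∈ B ↔ v ∈ B) then (1 : ℝ) else 0)) ^ 2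
          ≤ ∑ u : V, ∑ v : V, 1 :=
            sum_le_sum fun u _ => sum_le_sum fun v _ => by split_ifs <;> norm_num
        _ = (Fintype.card V : ℝ) ^ 2 := by simp [sq]) (4 * N)
  refine (measureReal_mono ?_).trans (h.trans (Real.exp_le_exp.2 (by linarith)))
  intro ω hω
  simp only [Set.mem_ofPred_eq, not_le, neg_mul, sum_neg_distrib] at hω ⊢
  linarith

/-- Let `s = #S`, `t = #T`, `L = 1 + log (N/t)`. The parameter `θ = log (e + N/(ds))` is chosen so
that the moment term is `2e·dst/N + 2t`, while `θk = 6dst/N + 6tL`. As `e < 3` and `L ≥ 1`, a pair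
of sets fails with probability at most `exp (-4tL)`. -/
theorem measure_not_discrepancy_le [Nonempty V] (hd : 0 < d)
    (hp : ∀ e, (p e : ℝ) ≤ 2 * d / Fintype.card V) :
    (indepLaw p).real {ω | ¬ ∀ S T : Finset V, S ⊆ T → S.Nonempty →
      ∑ u ∈ S, ∑ v ∈ T, edge ω u v ≤ 12 * d * #S * #T / Fintype.card V +
      12 * #T * (1 + Real.log (Fintype.card V / #T)) /
        Real.log (Real.exp 1 + Fintype.card V / (d * #S))} ≤
      1 / Fintype.card V := by
  have hN : (0 : ℝ) < Fintype.card V := by exact_mod_cast Fintype.card_pos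
  set N : ℝ := ((Fintype.card V : ℕ) : ℝ) with hNdef
  set f : ℕ → ℝ := fun t => if t = 0 then 0 else Real.exp (-(4 * (t * (1 + Real.log (N / t)))))
    with hf
  have hf0 : ∀ t, 0 ≤ f t := fun t => by
    simp only [hf]; split_ifs <;> positivity
  set E : Finset V → Finset V → Set (Sym2 V → Prop) := fun S T => {ω | S.Nonempty ∧
      12 * d * #S * #T / N + 12 * #T * (1 + Real.log (N / #T)) /
        Real.log (Real.exp 1 + N / (d * #S)) ≤ ∑ u ∈ S, ∑ v ∈ T, edge ω u v} with hE
  have key : ∀ T : Finset V, ∀ S ∈ T.powerset, (indepLaw p).real (E S T) ≤ f #T := by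
    intro T S hST
    rw [mem_powerset] at hST
    rcases S.eq_empty_or_nonempty with hS | hS
    · have : E S T = ∅ := by
        ext ω; simp [hE, hS]
      rw [this]
      simpa using hf0 _
    have hs : (0 : ℝ) < #S := by exact_mod_cast hS.card_pos
    have ht : 0 < #T := (hS.mono hST).card_pos
    have ht' : (1 : ℝ) ≤ #T := by exact_mod_cast ht
    have htN : (#T : ℝ) ≤ N := by
      rw [hNdef]; exact_mod_cast card_le_univ T
    set L := 1 + Real.log (N / #T) with hL
    have hL1 : 1 ≤ L := by
      have := Real.log_nonneg ((one_le_div (by linarith)).2 htN)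
      linarith
    set θ := Real.log (Real.exp 1 + N / (d * #S)) with hθ
    have hpos : 0 < N / (d * #S) := by positivity
    have hθ1 : 1 ≤ θ := by
      rw [hθ, Real.le_log_iff_exp_le (by positivity)]
      exact le_add_of_nonneg_right hpos.le
    have hexp : Real.exp θ = Real.exp 1 + N / (d * #S) := Real.exp_log (by positivity)
    set k := (6 * d * #S * #T / N + 6 * #T * L) / θ with hk
    have hsub : E S T ⊆ {ω | 2 * k ≤ ∑ u ∈ S, ∑ v ∈ T, edge ω u v} := by
      rintro ω ⟨-, hω⟩
      refine le_trans ?_ hω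
      have h1 : 12 * d * #S * #T / N / θ ≤ 12 * d * #S * #T / N :=
        div_le_self (by positivity) hθ1
      calc 2 * k = 12 * d * #S * #T / N / θ + 12 * #T * L / θ := by rw [hk]; ring
        _ ≤ _ := by gcongr
    refine (measureReal_mono hsub).trans
      ((edgeCount_chernoff p hp (by positivity) S T (by linarith : 0 ≤ θ) k).trans ?_)
    simp only [hf, if_neg ht.ne']
    rw [Real.exp_le_exp, hexp]
    have h1 : θ * k = 6 * d * #S * #T / N + 6 * #T * L := by
      rw [hk]; field_simp
    have h2 : 2 * d / N * (#S * #T) * (Real.exp 1 + N / (d * #S)) =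
        Real.exp 1 * (2 * (d * #S * #T / N)) + 2 * #T := by
      field_simp
    have h3 : Real.exp 1 * (2 * (d * #S * #T / N)) ≤ 3 * (2 * (d * #S * #T / N)) := by
      have := Real.exp_one_lt_d9
      gcongr
      linarith
    have h4 : (#T : ℝ) ≤ #T * L := le_mul_of_one_le_right (by linarith) hL1
    rw [h1, h2]
    have h5 : 6 * d * #S * #T / N = 3 * (2 * (d * #S * #T / N)) := by ring
    rw [h5]
    nlinarith
  -- There are `N.choose t` sets `T` and `2 ^ t` subsets `S` of each; both counts are at most `exp
  -- (tL)`. What remains is `exp (-2tL) ≤ N⁻²`, to be summed over `N` values of `t`.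
  have hterm : ∀ t ∈ range (Fintype.card V + 1),
      ((Fintype.card V).choose t : ℝ) * (2 ^ t * f t) ≤ if t = 0 then 0 else N⁻¹ ^ 2 := by
    intro t ht
    rcases Nat.eq_zero_or_pos t with h0 | h0
    · simp [h0, hf]
    rw [if_neg h0.ne']
    simp only [hf, if_neg h0.ne']
    have htV : t ≤ Fintype.card V := Nat.lt_succ_iff.1 (mem_range.1 ht)
    have h1 := choose_le_exp_mul_log h0 Fintype.card_pos (n := Fintype.card V)
    have h2 := one_add_log_le_mul_one_add_log_div h0 htV
    rw [← hNdef] at h1 h2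
    set y := (t : ℝ) * (1 + Real.log (N / t)) with hy
    have hty : (t : ℝ) ≤ y := by
      have h3 : (1 : ℝ) ≤ N / t := by
        rw [one_le_div (by positivity), hNdef]; exact_mod_cast htV
      have := Real.log_nonneg h3
      rw [hy]
      exact le_mul_of_one_le_right (by positivity) (by linarith)
    have h4 : (2 : ℝ) ^ t ≤ Real.exp y := by
      calc (2 : ℝ) ^ t ≤ Real.exp 1 ^ t := by
            gcongr
            have := Real.add_one_le_exp 1
            linarith
        _ = Real.exp t := by rw [← Real.exp_nat_mul, mul_one]
        _ ≤ Real.exp y := Real.exp_le_exp.2 hty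
    calc ((Fintype.card V).choose t : ℝ) * (2 ^ t * Real.exp (-(4 * y)))
        ≤ Real.exp y * (Real.exp y * Real.exp (-(4 * y))) := by gcongr
      _ = Real.exp (-(2 * y)) := by rw [← Real.exp_add, ← Real.exp_add]; ring_nf
      _ ≤ Real.exp (-(2 * Real.log N)) := by
        gcongr
        linarith
      _ = N⁻¹ ^ 2 := by
        rw [show -(2 * Real.log N) = ((2 : ℕ) : ℝ) * (-Real.log N) by push_cast; ring,
          Real.exp_nat_mul, Real.exp_neg, Real.exp_log hN]
  have hsub : {ω : Sym2 V → Prop | ¬ ∀ S T : Finset V, S ⊆ T → S.Nonempty →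
      ∑ u ∈ S, ∑ v ∈ T, edge ω u v ≤ 12 * d * #S * #T / N +
      12 * #T * (1 + Real.log (N / #T)) / Real.log (Real.exp 1 + N / (d * #S))} ⊆
      ⋃ T ∈ (univ : Finset V).powerset, ⋃ S ∈ T.powerset, E S T := by
    intro ω hω
    simp only [Set.mem_ofPred_eq, not_forall, not_le] at hω
    obtain ⟨S, T, hST, hS, h⟩ := hω
    simp only [Set.mem_iUnion]
    exact ⟨T, mem_powerset.2 (subset_univ _), S, mem_powerset.2 hST, hS, h.le⟩
  calc _ ≤ (indepLaw p).real _ := measureReal_mono hsub (measure_ne_top _ _)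
    _ ≤ ∑ T ∈ (univ : Finset V).powerset, (indepLaw p).real (⋃ S ∈ T.powerset, E S T) :=
      measureReal_biUnion_finset_le _ _
    _ ≤ ∑ T ∈ (univ : Finset V).powerset, ∑ S ∈ T.powerset, (indepLaw p).real (E S T) :=
      sum_le_sum fun T _ => measureReal_biUnion_finset_le _ _
    _ ≤ ∑ T ∈ (univ : Finset V).powerset, ∑ S ∈ T.powerset, f #T :=
      sum_le_sum fun T _ => sum_le_sum fun S hS => key T S hS
    _ = ∑ T ∈ (univ : Finset V).powerset, 2 ^ #T * f #T := by
      simp [sum_const]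
    _ = ∑ t ∈ range (Fintype.card V + 1), ((Fintype.card V).choose t : ℝ) * (2 ^ t * f t) := by
      rw [sum_powerset_apply_card (fun t => 2 ^ t * f t), card_univ]
      simp only [nsmul_eq_mul]
    _ ≤ ∑ t ∈ range (Fintype.card V + 1), if t = 0 then 0 else N⁻¹ ^ 2 := sum_le_sum hterm
    _ = N * N⁻¹ ^ 2 := by
      rw [sum_range_succ']; simp [hNdef]
    _ = 1 / N := by field_simp

theorem measure_not_isRegular_le [Nonempty V] (hd : 1 ≤ d)
    (hp : ∀ e, (p e : ℝ) ≤ 2 * d / Fintype.card V) (B : Finset V) :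
    (indepLaw p).real {ω | ¬ IsRegular d p B ω} ≤ 5 / Fintype.card V := by
  have hd0 : 0 < d := by linarith
  have hN : (0 : ℝ) < Fintype.card V := by exact_mod_cast Fintype.card_pos
  have hexp : Real.exp (-Fintype.card V) ≤ 1 / (Fintype.card V : ℝ) := by
    rw [Real.exp_neg, inv_eq_one_div]
    gcongr
    have := Real.add_one_le_exp (Fintype.card V : ℝ)
    linarith
  have h1 := measure_not_light_le hd0 hp
  have h2 := measure_not_degrees_le hd hp
  have h3 := measure_not_block_le hd hp B
  have h4 := measure_not_discrepancy_le hd0 hp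
  set E1 : Set (Sym2 V → Prop) :=
    {ω | ¬ ∀ z ∈ latticeBall V, |lightForm d p ω (scaled z)| ≤ 40 * √d}
  set E2 : Set (Sym2 V → Prop) := {ω | ¬ ∀ S : Finset V,
      ∑ u ∈ S, ∑ v, (edge ω u v - meanEdge p u v) ≤ 6 * √d * Fintype.card V}
  set E3 : Set (Sym2 V → Prop) := {ω | ¬ -(4 * √d * Fintype.card V) ≤
      ∑ u, ∑ v, (if (u ∈ B ↔ v ∈ B) then 1 else 0) * (edge ω u v - meanEdge p u v)}
  set E4 : Set (Sym2 V → Prop) := {ω | ¬ ∀ S T : Finset V, S ⊆ T → S.Nonempty →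
      ∑ u ∈ S, ∑ v ∈ T, edge ω u v ≤ 12 * d * #S * #T / Fintype.card V +
      12 * #T * (1 + Real.log (Fintype.card V / #T)) /
        Real.log (Real.exp 1 + Fintype.card V / (d * #S))}
  have hsub : {ω : Sym2 V → Prop | ¬ IsRegular d p B ω} ⊆ (E1 ∪ E2) ∪ (E3 ∪ E4) := by
    intro ω hω
    by_contra h
    simp only [E1, E2, E3, E4, Set.mem_union, Set.mem_ofPred_eq, not_or] at h
    obtain ⟨⟨g1, g2⟩, g3, g4⟩ := h
    exact hω ⟨not_not.1 g1, not_not.1 g2, not_not.1 g3, not_not.1 g4⟩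
  have h5 := measureReal_mono (μ := indepLaw p) hsub
  have h6 := measureReal_union_le (μ := indepLaw p) (E1 ∪ E2) (E3 ∪ E4)
  have h7 := measureReal_union_le (μ := indepLaw p) E1 E2
  have h8 := measureReal_union_le (μ := indepLaw p) E3 E4
  have h9 : (5 : ℝ) / Fintype.card V = 5 * (1 / Fintype.card V) := by ring
  rw [h9]
  linarith

end Regularity

/-! ### The contribution of the pairs with a large product -/

lemma sum_pow_le_of_le {q B : ℝ} (hq : 1 < q) (hB : 0 ≤ B) (K : ℕ) :
    ∑ i ∈ range K, (if q ^ i ≤ B then q ^ i else 0) ≤ q / (q - 1) * B := by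
  have hq1 : 0 < q - 1 := by linarith
  induction K with
  | zero => simpa using by positivity
  | succ K ih =>
    by_cases h : q ^ K ≤ B
    · calc ∑ i ∈ range (K + 1), (if q ^ i ≤ B then q ^ i else 0)
          ≤ ∑ i ∈ range (K + 1), q ^ i := by
            refine sum_le_sum fun i _ => ?_
            split_ifs
            exacts [le_rfl, by positivity]
        _ = (q ^ (K + 1) - 1) / (q - 1) := geom_sum_eq hq.ne' _
        _ ≤ q ^ (K + 1) / (q - 1) := by gcongr; linarith
        _ = q / (q - 1) * q ^ K := by ring
        _ ≤ q / (q - 1) * B := by gcongr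
    · rw [sum_range_succ, if_neg h, add_zero]
      exact ih

lemma one_add_pow_four_le (j : ℕ) : (1 + j) ^ 4 ≤ 64 * 2 ^ j := by
  rcases lt_or_ge j 6 with h | h
  · interval_cases j <;> norm_num
  · induction j, h using Nat.le_induction with
    | base => norm_num
    | succ j hj ih =>
      have : (1 + (j + 1)) ^ 4 ≤ 2 * (1 + j) ^ 4 := by
        obtain ⟨k, rfl⟩ := Nat.exists_eq_add_of_le hj
        ring_nf
        nlinarith [Nat.zero_le k]
      calc (1 + (j + 1)) ^ 4 ≤ 2 * (1 + j) ^ 4 := this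
        _ ≤ 2 * (64 * 2 ^ j) := by gcongr
        _ = 64 * 2 ^ (j + 1) := by ring

/-- If `r² 2^j ≥ 1`, the logarithm is at least `j log 2`. Otherwise `√r` is exponentially small in
`j` and absorbs `1 + j`. Keeping a factor `√r` on the right makes the later sum over levels
geometric. -/
lemma mul_one_add_le_sqrt_mul_log {r : ℝ} (hr : 0 < r) (hr2 : r ≤ 2) (j : ℕ) :
    r * (1 + j) ≤ 5 * √r * Real.log (Real.exp 1 + r ^ 2 * 4 ^ j) := by
  set θ := Real.log (Real.exp 1 + r ^ 2 * 4 ^ j)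
  have hs : 0 < √r := Real.sqrt_pos.2 hr
  have hss : √r * √r = r := Real.mul_self_sqrt hr.le
  have hθ : 1 ≤ θ := by
    rw [Real.le_log_iff_exp_le (by positivity)]
    exact le_add_of_nonneg_right (by positivity)
  suffices h : √r * (1 + j) ≤ 5 * θ by
    calc r * (1 + j) = √r * (√r * (1 + j)) := by rw [← mul_assoc, hss]
      _ ≤ √r * (5 * θ) := by gcongr
      _ = 5 * √r * θ := by ring
  rcases le_or_gt 1 (r ^ 2 * 2 ^ j) with h | h
  · have h1 : (j : ℝ) / 2 ≤ θ := by
      have h2 : Real.log (2 ^ j) ≤ θ := by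
        refine Real.log_le_log (by positivity) ?_
        have : (4 : ℝ) ^ j = 2 ^ j * 2 ^ j := by rw [← mul_pow]; norm_num
        rw [this]
        have h3 : (2 : ℝ) ^ j ≤ r ^ 2 * 2 ^ j * 2 ^ j := le_mul_of_one_le_left (by positivity) h
        have := Real.exp_pos 1
        linarith
      rw [Real.log_pow] at h2
      have := Real.log_two_gt_d9
      have h4 : (j : ℝ) * (1 / 2) ≤ j * Real.log 2 := by gcongr; linarith
      linarith
    have h5 : √r ≤ 5 / 3 := Real.sqrt_le_iff.2 ⟨by norm_num, by linarith⟩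
    calc √r * (1 + j) ≤ 5 / 3 * (1 + j) := by gcongr
      _ ≤ 5 * θ := by linarith
  · have h1 : (√r * (1 + j)) ^ 4 ≤ 5 ^ 4 := by
      have h2 : √r ^ 4 = r ^ 2 := by
        rw [show √r ^ 4 = (√r * √r) ^ 2 by ring, hss]
      have h3 : ((1 + j : ℝ)) ^ 4 ≤ 64 * 2 ^ j := by exact_mod_cast one_add_pow_four_le j
      rw [mul_pow, h2]
      calc r ^ 2 * (1 + j : ℝ) ^ 4 ≤ r ^ 2 * (64 * 2 ^ j) := by gcongr
        _ = 64 * (r ^ 2 * 2 ^ j) := by ring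
        _ ≤ 5 ^ 4 := by linarith
    have h6 : √r * (1 + j) ≤ 5 := le_of_pow_le_pow_left₀ (by norm_num) (by norm_num) h1
    linarith

/-- Apply `mul_one_add_le_sqrt_mul_log` to `r = 2^i / (√d 2^j)`, for which `r² 4^j = 4^i / d`. The
sum over `i` is then geometric with ratio `√2`. The gain `1 / (1 + j)` pays for the entropy factor
`1 + j` in `mul_one_add_log_le`. -/
lemma sum_two_pow_div_log_le {d : ℝ} (hd : 1 ≤ d) (K j : ℕ) :
    ∑ i ∈ range K, (if (2 : ℝ) ^ i ≤ 2 * √d * 2 ^ j then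
      2 ^ i / 2 ^ j / Real.log (Real.exp 1 + 4 ^ i / d) else 0) ≤ 30 * √d / (1 + j) := by
  have hs : 0 < √d := Real.sqrt_pos.2 (by linarith)
  have hss : √d ^ 2 = d := Real.sq_sqrt (by linarith)
  set R : ℝ := √d * 2 ^ j with hR
  have hR0 : 0 < R := by positivity
  have hterm : ∀ i : ℕ, (if (2 : ℝ) ^ i ≤ 2 * √d * 2 ^ j then
      2 ^ i / 2 ^ j / Real.log (Real.exp 1 + 4 ^ i / d) else 0) ≤
      5 * √d / ((1 + j) * √R) * (if √2 ^ i ≤ √(2 * R) then √2 ^ i else 0) := by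
    intro i
    have h4 : √2 ^ i = √(2 ^ i) := by
      rw [Real.sqrt_eq_rpow, Real.sqrt_eq_rpow, ← Real.rpow_natCast, ← Real.rpow_mul (by norm_num),
        mul_comm, Real.rpow_mul (by norm_num), Real.rpow_natCast]
    by_cases h : (2 : ℝ) ^ i ≤ 2 * √d * 2 ^ j
    · have h' : (2 : ℝ) ^ i ≤ 2 * R := by rw [hR]; linarith
      rw [if_pos h, if_pos (by rw [h4]; exact Real.sqrt_le_sqrt h')]
      have key := mul_one_add_le_sqrt_mul_log (r := 2 ^ i / R) (by positivity)
        (by rwa [div_le_iff₀ hR0]) j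
      have h5 : (2 ^ i / R) ^ 2 * 4 ^ j = (4 : ℝ) ^ i / d := by
        have h44 : ∀ m : ℕ, (4 : ℝ) ^ m = (2 ^ m) ^ 2 := fun m => by
          rw [← pow_mul, mul_comm, pow_mul]; norm_num
        rw [hR, div_pow, mul_pow, hss, h44, h44]
        field_simp
      rw [h5, Real.sqrt_div' _ hR0.le, ← h4] at key
      have hθ : 0 < Real.log (Real.exp 1 + 4 ^ i / d) := by
        refine Real.log_pos ?_
        have := Real.add_one_le_exp 1
        have : 0 < (4 : ℝ) ^ i / d := by positivity
        linarith
      have hsR : 0 < √R := Real.sqrt_pos.2 hR0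
      rw [div_le_iff₀ hθ]
      have h6 : (2 : ℝ) ^ i / 2 ^ j = √d / (1 + j) * (2 ^ i / R * (1 + j)) := by
        rw [hR]; field_simp
      rw [h6]
      calc √d / (1 + j) * (2 ^ i / R * (1 + j))
          ≤ √d / (1 + j) * (5 * (√2 ^ i / √R) * Real.log (Real.exp 1 + 4 ^ i / d)) := by gcongr
        _ = 5 * √d / ((1 + j) * √R) * √2 ^ i * Real.log (Real.exp 1 + 4 ^ i / d) := by
          field_simp
    · rw [if_neg h]
      refine mul_nonneg (by positivity) ?_
      split_ifs
      exacts [by positivity, le_rfl]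
  have h2 : 7 / 5 ≤ √2 := Real.le_sqrt_of_sq_le (by norm_num)
  have h2' : √2 ≤ 3 / 2 := Real.sqrt_le_iff.2 ⟨by norm_num, by norm_num⟩
  have hsR : 0 < √R := Real.sqrt_pos.2 hR0
  have hgeom := sum_pow_le_of_le (q := √2) (B := √(2 * R)) (by linarith) (Real.sqrt_nonneg _) K
  have hq : √2 / (√2 - 1) ≤ 4 := by
    rw [div_le_iff₀ (by linarith)]; linarith
  calc _ ≤ ∑ i ∈ range K, 5 * √d / ((1 + j) * √R) *
        (if √2 ^ i ≤ √(2 * R) then √2 ^ i else 0) := sum_le_sum fun i _ => hterm i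
    _ = 5 * √d / ((1 + j) * √R) *
        ∑ i ∈ range K, (if √2 ^ i ≤ √(2 * R) then √2 ^ i else 0) := by rw [mul_sum]
    _ ≤ 5 * √d / ((1 + j) * √R) * (4 * (3 / 2 * √R)) := by
      gcongr
      refine hgeom.trans ?_
      rw [Real.sqrt_mul (by norm_num)]
      gcongr
    _ = 30 * √d / (1 + j) := by field_simp; norm_num

/-- The tangent bound for `log` at the scale `exp (-j)` gives `α log (1/α) ≤ jα + exp (-j)`. The
right-hand side without `1 + j` is then summable over levels. -/
lemma mul_one_add_log_le {α : ℝ} (hα : 0 ≤ α) (j : ℕ) :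
    α * (1 + Real.log (4 ^ j / α)) ≤ (1 + j) * (3 * α + (1 / 2) ^ j) := by
  rcases hα.eq_or_lt with rfl | hα
  · rw [zero_mul]; positivity
  have h1 : Real.log (4 ^ j / α) = j * Real.log 4 + Real.log α⁻¹ := by
    rw [div_eq_mul_inv, Real.log_mul (by positivity) (by positivity), Real.log_pow]
  have h4 : Real.log 4 ≤ 2 := by
    have := Real.log_two_lt_d9
    rw [show (4 : ℝ) = 2 ^ 2 by norm_num, Real.log_pow]
    push_cast
    linarith
  have h2 : Real.log α⁻¹ ≤ α⁻¹ * Real.exp (-j) - 1 + j := by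
    have := Real.log_le_sub_one_of_pos (x := α⁻¹ * Real.exp (-j)) (by positivity)
    rw [Real.log_mul (by positivity) (by positivity), Real.log_exp] at this
    linarith
  have h3 : Real.exp (-j) ≤ (1 / 2 : ℝ) ^ j := by
    rw [show -(j : ℝ) = j * (-1) by ring, Real.exp_nat_mul]
    gcongr
    rw [Real.exp_neg, one_div]
    gcongr
    have := Real.add_one_le_exp 1
    linarith
  have hj : (0 : ℝ) ≤ j := by positivity
  have hp : (0 : ℝ) ≤ (1 / 2) ^ j := by positivity
  calc α * (1 + Real.log (4 ^ j / α))
      ≤ α * (1 + (j * 2 + (α⁻¹ * Real.exp (-j) - 1 + j))) := by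
        rw [h1]; gcongr
    _ = α * (3 * j) + Real.exp (-j) := by field_simp; ring
    _ ≤ α * (3 * j) + (1 / 2) ^ j := by gcongr
    _ ≤ (1 + j) * (3 * α + (1 / 2) ^ j) := by nlinarith [mul_nonneg hj hp]

/-- A sum over dyadic levels: `s i` is the size of the `i`-th level, `e i j` the number of edges
between the levels `i` and `j`. -/
theorem level_sum_le {N d : ℝ} (hN : 0 < N) (hd : 1 ≤ d) (K : ℕ) (s : ℕ → ℝ) (e : ℕ → ℕ → ℝ)
    (hs0 : ∀ i, 0 ≤ s i) (hs1 : ∀ i, s i * 4 ^ i ≤ N)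
    (hsum : ∑ i ∈ range K, s i * 4 ^ i ≤ 4 / 3 * N) (he0 : ∀ i j, s i = 0 → e i j = 0)
    (he : ∀ i j, j ≤ i → 0 < s i → e i j ≤ 12 * d * s i * s j / N +
      12 * s j * (1 + Real.log (N / s j)) / Real.log (Real.exp 1 + N / (d * s i))) :
    ∑ i ∈ range K, ∑ j ∈ range K,
      (if j ≤ i ∧ (2 : ℝ) ^ i ≤ 2 * √d * 2 ^ j ∧ √d ≤ 4 * (2 ^ i * 2 ^ j) then
        4 * (2 ^ i * 2 ^ j) * e i j else 0) ≤ 9000 * √d * N := by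
  have hs : 0 < √d := Real.sqrt_pos.2 (by linarith)
  have hss : √d * √d = d := Real.mul_self_sqrt (by linarith)
  -- `α i` is the share of the squared norm carried by level `i`. The density term of `he` becomes a
  -- product `α i * α j`, and the entropy term becomes `g j * 2^(i-j) / θ i`, which is summed over
  -- `i` before `j`.
  set α : ℕ → ℝ := fun i => s i * 4 ^ i / N with hα
  have hα0 : ∀ i, 0 ≤ α i := fun i => by have := hs0 i; simp only [hα]; positivity
  have hα1 : ∀ i, α i ≤ 1 := fun i => by simp only [hα]; exact (div_le_one hN).2 (hs1 i)
  have hαsum : ∑ i ∈ range K, α i ≤ 4 / 3 := by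
    simp only [hα, ← sum_div]
    rwa [div_le_iff₀ hN]
  have h44 : ∀ m : ℕ, (4 : ℝ) ^ m = 2 ^ m * 2 ^ m := fun m => by rw [← mul_pow]; norm_num
  have hsα : ∀ i, s i = α i * N / (2 ^ i * 2 ^ i) := fun i => by
    simp only [hα, h44]; field_simp
  set g : ℕ → ℝ := fun j => α j * (1 + Real.log (4 ^ j / α j)) with hg
  have hg0 : ∀ j, 0 ≤ g j := fun j => by
    rcases (hα0 j).eq_or_lt with h | h
    · simp [hg, ← h]
    · refine mul_nonneg (hα0 j) ?_
      have h1 : (1 : ℝ) ≤ 4 ^ j / α j := by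
        rw [one_le_div h]
        exact (hα1 j).trans (one_le_pow₀ (by norm_num))
      have := Real.log_nonneg h1
      linarith
  set θ : ℕ → ℝ := fun i => Real.log (Real.exp 1 + 4 ^ i / d) with hθ
  have hθ0 : ∀ i, 0 < θ i := fun i => by
    refine Real.log_pos ?_
    have := Real.add_one_le_exp 1
    have : 0 < (4 : ℝ) ^ i / d := by positivity
    linarith
  have hterm : ∀ i j : ℕ,
      (if j ≤ i ∧ (2 : ℝ) ^ i ≤ 2 * √d * 2 ^ j ∧ √d ≤ 4 * (2 ^ i * 2 ^ j) then
        4 * (2 ^ i * 2 ^ j) * e i j else 0) ≤ 192 * √d * N * (α i * α j) +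
        48 * N * (g j * (if (2 : ℝ) ^ i ≤ 2 * √d * 2 ^ j then 2 ^ i / 2 ^ j / θ i else 0)) := by
    intro i j
    have hr1 : 0 ≤ 192 * √d * N * (α i * α j) := by
      have := hα0 i; have := hα0 j; positivity
    have hr2 : 0 ≤ 48 * N * (g j *
        (if (2 : ℝ) ^ i ≤ 2 * √d * 2 ^ j then 2 ^ i / 2 ^ j / θ i else 0)) := by
      have := hg0 j
      have := hθ0 i
      split_ifs <;> positivity
    split_ifs with h h' h'
    · obtain ⟨hji, -, h3⟩ := h
      rcases (hs0 i).eq_or_lt with hi | hi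
      · rw [he0 i j hi.symm, mul_zero]
        rw [if_pos h'] at hr2
        linarith
      have h1 := he i j hji hi
      have h5 : 12 * s j * (1 + Real.log (N / s j)) / Real.log (Real.exp 1 + N / (d * s i)) ≤
          12 * (N / (2 ^ j * 2 ^ j) * g j) / θ i := by
        have hnum : 12 * s j * (1 + Real.log (N / s j)) = 12 * (N / (2 ^ j * 2 ^ j) * g j) := by
          rcases (hs0 j).eq_or_lt with hj | hj
          · simp [hg, hα, ← hj]
          · have h6 : N / s j = 4 ^ j / α j := by simp only [hα]; field_simp
            rw [h6]
            simp only [hg]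
            rw [hsα j]; field_simp
        rw [hnum]
        have hpos : 0 ≤ 12 * (N / (2 ^ j * 2 ^ j) * g j) := by
          have := hg0 j; positivity
        refine div_le_div_of_nonneg_left hpos (hθ0 i) ?_
        refine Real.log_le_log (by positivity) ?_
        have h8 : (4 : ℝ) ^ i / d ≤ N / (d * s i) := by
          rw [div_le_div_iff₀ (by linarith) (by positivity)]
          have := hs1 i
          nlinarith
        linarith
      have h7 : 4 * (2 ^ i * 2 ^ j) * (12 * d * s i * s j / N) ≤ 192 * √d * N * (α i * α j) := by
        rw [hsα i, hsα j]
        have h8 : 4 * (2 ^ i * 2 ^ j) * (12 * d * (α i * N / (2 ^ i * 2 ^ i)) *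
            (α j * N / (2 ^ j * 2 ^ j)) / N) =
            48 * √d * N * (α i * α j) * (√d / (2 ^ i * 2 ^ j)) := by
          field_simp
          rw [Real.sq_sqrt (by linarith)]
          ring
        rw [h8]
        have h9 : √d / (2 ^ i * 2 ^ j) ≤ 4 := by
          rw [div_le_iff₀ (by positivity)]; exact h3
        have : 0 ≤ 48 * √d * N * (α i * α j) := by linarith
        calc 48 * √d * N * (α i * α j) * (√d / (2 ^ i * 2 ^ j))
            ≤ 48 * √d * N * (α i * α j) * 4 := by gcongr
          _ = _ := by ring
      calc 4 * (2 ^ i * 2 ^ j) * e i j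
          ≤ 4 * (2 ^ i * 2 ^ j) * (12 * d * s i * s j / N +
            12 * (N / (2 ^ j * 2 ^ j) * g j) / θ i) := by gcongr; linarith
        _ = 4 * (2 ^ i * 2 ^ j) * (12 * d * s i * s j / N) +
            48 * N * (g j * (2 ^ i / 2 ^ j / θ i)) := by
          have := (hθ0 i).ne'
          field_simp
          ring
        _ ≤ _ := by gcongr
    · exact absurd h.2.1 h'
    · rw [if_pos h'] at hr2; linarith
    · rw [if_neg h'] at hr2; linarith
  have hhalf : ∑ j ∈ range K, (1 / 2 : ℝ) ^ j ≤ 2 := by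
    rw [geom_sum_eq (by norm_num), div_le_iff_of_neg (by norm_num)]
    have : (0 : ℝ) ≤ (1 / 2) ^ K := by positivity
    linarith
  have hsec : ∑ i ∈ range K, ∑ j ∈ range K,
      g j * (if (2 : ℝ) ^ i ≤ 2 * √d * 2 ^ j then 2 ^ i / 2 ^ j / θ i else 0) ≤ 180 * √d := by
    rw [sum_comm]
    calc _ = ∑ j ∈ range K, g j * ∑ i ∈ range K,
          (if (2 : ℝ) ^ i ≤ 2 * √d * 2 ^ j then 2 ^ i / 2 ^ j / θ i else 0) := by
          simp only [mul_sum]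
      _ ≤ ∑ j ∈ range K, ((1 + j) * (3 * α j + (1 / 2) ^ j)) * (30 * √d / (1 + j)) := by
        refine sum_le_sum fun j _ => mul_le_mul (mul_one_add_log_le (hα0 j) j)
          (sum_two_pow_div_log_le hd K j) (sum_nonneg fun i _ => ?_) ?_
        · have := hθ0 i
          split_ifs <;> positivity
        · have := hα0 j; positivity
      _ = 30 * √d * (3 * ∑ j ∈ range K, α j + ∑ j ∈ range K, (1 / 2 : ℝ) ^ j) := by
        rw [mul_sum, ← sum_add_distrib, mul_sum]
        refine sum_congr rfl fun j _ => ?_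
        field_simp
      _ ≤ 30 * √d * (3 * (4 / 3) + 2) := by gcongr
      _ = 180 * √d := by ring
  have hfirst : ∑ i ∈ range K, ∑ j ∈ range K, α i * α j ≤ 16 / 9 := by
    rw [← sum_mul_sum]
    have h0 : 0 ≤ ∑ i ∈ range K, α i := sum_nonneg fun i _ => hα0 i
    nlinarith
  calc _ ≤ ∑ i ∈ range K, ∑ j ∈ range K, (192 * √d * N * (α i * α j) +
        48 * N * (g j * (if (2 : ℝ) ^ i ≤ 2 * √d * 2 ^ j then 2 ^ i / 2 ^ j / θ i else 0))) :=
        sum_le_sum fun i _ => sum_le_sum fun j _ => hterm i j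
    _ = 192 * √d * N * ∑ i ∈ range K, ∑ j ∈ range K, α i * α j +
        48 * N * ∑ i ∈ range K, ∑ j ∈ range K,
          g j * (if (2 : ℝ) ^ i ≤ 2 * √d * 2 ^ j then 2 ^ i / 2 ^ j / θ i else 0) := by
      simp only [sum_add_distrib, mul_sum]
    _ ≤ 192 * √d * N * (16 / 9) + 48 * N * (180 * √d) := by gcongr
    _ ≤ 9000 * √d * N := by
      have : 0 < √d * N := by positivity
      nlinarith

section Heavy

variable {V : Type*} [Fintype V] [DecidableEq V]

omit [DecidableEq V] in
lemma sum_le_two_mul_sum_of_symm (h : V → V → ℝ) (y : V → ℝ) (h0 : ∀ u v, 0 ≤ h u v)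
    (hs : ∀ u v, h u v = h v u) :
    ∑ u, ∑ v, h u v ≤ 2 * ∑ u, ∑ v, if y v ≤ y u then h u v else 0 := by
  have h1 : ∑ u, ∑ v, (if y v ≤ y u then h u v else 0) =
      ∑ u, ∑ v, if y u ≤ y v then h u v else 0 := by
    rw [sum_comm]
    exact sum_congr rfl fun u _ => sum_congr rfl fun v _ => by rw [hs]
  rw [two_mul]
  nth_rw 2 [h1]
  rw [← sum_add_distrib]
  refine sum_le_sum fun u _ => ?_
  rw [← sum_add_distrib]
  refine sum_le_sum fun v _ => ?_
  have := h0 u v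
  rcases le_total (y v) (y u) with h | h
  · rw [if_pos h]; split_ifs <;> linarith
  · rw [if_pos h]; split_ifs <;> linarith

/-- By symmetry take `y v ≤ y u`, at the cost of a factor `2`. If `√d * y v < y u`, the product is
at most `y u ^ 2 / √d` and the degree bound suffices. Otherwise the values are comparable up to
`√d`, and the dyadic level estimate applies. The constant is `2 (20 + 9000)`. -/
theorem heavy_sum_le [Nonempty V] {d : ℝ} (hd : 1 ≤ d) (E : V → V → ℝ) (hE0 : ∀ u v, 0 ≤ E u v)
    (hEs : ∀ u v, E u v = E v u)
    (hE : ∀ S T : Finset V, S ⊆ T → S.Nonempty →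
      ∑ u ∈ S, ∑ v ∈ T, E u v ≤ 12 * d * #S * #T / Fintype.card V +
        12 * #T * (1 + Real.log (Fintype.card V / #T)) /
          Real.log (Real.exp 1 + Fintype.card V / (d * #S)))
    (y : V → ℝ) (hy0 : ∀ u, 0 ≤ y u) (hy : ∑ u, y u ^ 2 ≤ Fintype.card V)
    (hdeg : ∀ u, y u ≠ 0 → ∑ v, E u v ≤ 20 * d) :
    ∑ u, ∑ v, (if √d < y u * y v then E u v * (y u * y v) else 0) ≤
      18040 * √d * Fintype.card V := by
  have hs : 1 ≤ √d := Real.one_le_sqrt.2 hd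
  have hss : √d * √d = d := Real.mul_self_sqrt (by linarith)
  have hN : (0 : ℝ) < Fintype.card V := by exact_mod_cast Fintype.card_pos
  set N : ℝ := ((Fintype.card V : ℕ) : ℝ) with hNdef
  obtain ⟨K, hK⟩ : ∃ K : ℕ, ∀ u, y u < 2 ^ K := by
    obtain ⟨K, hK⟩ := pow_unbounded_of_one_lt (∑ u, y u) (one_lt_two)
    exact ⟨K, fun u => (single_le_sum (fun u _ => hy0 u) (mem_univ u)).trans_lt hK⟩
  -- Superlevel sets rather than dyadic slices: they are nested, as `hE` demands, and the
  -- squared-norm budget only grows by the geometric factor `4/3`.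
  set U : ℕ → Finset V := fun i => univ.filter fun u => (2 : ℝ) ^ i ≤ y u with hU
  have hUmono : ∀ i j, j ≤ i → U i ⊆ U j := fun i j hji u hu => by
    simp only [hU, mem_filter, mem_univ, true_and] at hu ⊢
    exact (pow_le_pow_right₀ one_le_two hji).trans hu
  have h44 : ∀ m : ℕ, (4 : ℝ) ^ m = (2 ^ m) ^ 2 := fun m => by
    rw [← pow_mul, mul_comm, pow_mul]; norm_num
  have hcard : ∀ i, (#(U i) : ℝ) * 4 ^ i = ∑ u, if (2 : ℝ) ^ i ≤ y u then (4 : ℝ) ^ i else 0 := by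
    intro i
    rw [← sum_filter, sum_const, nsmul_eq_mul]
  have hle4 : ∀ i u, (2 : ℝ) ^ i ≤ y u → (4 : ℝ) ^ i ≤ y u ^ 2 := fun i u h => by
    rw [h44]; gcongr
  have hs1 : ∀ i, (#(U i) : ℝ) * 4 ^ i ≤ N := fun i => by
    rw [hcard]
    refine le_trans (sum_le_sum fun u _ => ?_) hy
    split_ifs with h
    exacts [hle4 i u h, sq_nonneg _]
  have hsum : ∑ i ∈ range K, (#(U i) : ℝ) * 4 ^ i ≤ 4 / 3 * N := by
    simp only [hcard]
    rw [sum_comm]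
    calc _ ≤ ∑ u, 4 / 3 * y u ^ 2 := by
          refine sum_le_sum fun u _ => ?_
          calc _ ≤ ∑ i ∈ range K, (if (4 : ℝ) ^ i ≤ y u ^ 2 then (4 : ℝ) ^ i else 0) := by
                refine sum_le_sum fun i _ => ?_
                split_ifs with h h' h'
                · exact le_rfl
                · exact absurd (hle4 i u h) h'
                · positivity
                · exact le_rfl
            _ ≤ 4 / (4 - 1) * y u ^ 2 := sum_pow_le_of_le (by norm_num) (sq_nonneg _) K
            _ = 4 / 3 * y u ^ 2 := by norm_num
      _ = 4 / 3 * ∑ u, y u ^ 2 := by rw [mul_sum]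
      _ ≤ 4 / 3 * N := by gcongr
  have hlevel := level_sum_le hN hd K (fun i => (#(U i) : ℝ))
    (fun i j => ∑ u ∈ U i, ∑ v ∈ U j, E u v) (fun i => by positivity) hs1 hsum
    (fun i j h => by
      have : U i = ∅ := by
        rw [← card_eq_zero]; exact_mod_cast h
      simp [this])
    (fun i j hji hi => hE (U i) (U j) (hUmono i j hji) (card_pos.1 (by exact_mod_cast hi)))
  set c : ℕ → ℕ → Prop := fun i j =>
    j ≤ i ∧ (2 : ℝ) ^ i ≤ 2 * √d * 2 ^ j ∧ √d ≤ 4 * (2 ^ i * 2 ^ j) with hc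
  have hpoint : ∀ u v, (if y v ≤ y u then
      (if √d < y u * y v then E u v * (y u * y v) else 0) else 0) ≤
      E u v * (y u ^ 2 / √d) + ∑ i ∈ range K, ∑ j ∈ range K, (if c i j then
        4 * (2 ^ i * 2 ^ j) * (if u ∈ U i then if v ∈ U j then E u v else 0 else 0) else 0) := by
    intro u v
    have hnn : ∀ i j, 0 ≤ (if c i j then
        4 * (2 ^ i * 2 ^ j) * (if u ∈ U i then if v ∈ U j then E u v else 0 else 0)
          else (0 : ℝ)) := fun i j => by
      have := hE0 u v
      split_ifs <;> positivity
    have hnn2 := sum_nonneg fun i (_ : i ∈ range K) =>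
      sum_nonneg fun j (_ : j ∈ range K) => hnn i j
    have hnn1 : 0 ≤ E u v * (y u ^ 2 / √d) := by
      have := hE0 u v; positivity
    split_ifs with h1 h2
    · have hyu := hy0 u
      have hyv := hy0 v
      rcases lt_or_ge (√d * y v) (y u) with h3 | h3
      · refine le_add_of_le_of_nonneg ?_ hnn2
        refine mul_le_mul_of_nonneg_left ?_ (hE0 u v)
        rw [le_div_iff₀ (by linarith)]
        nlinarith
      · refine le_add_of_nonneg_of_le hnn1 ?_
        -- From `√d < y u * y v ≤ √d * (y v)²`; hence nonnegative dyadic levels suffice.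
        have hv1 : 1 ≤ y v := by
          by_contra hlt
          push Not at hlt
          have h5 : y u * y v ≤ √d * (y v * y v) := by nlinarith
          have h6 : y v * y v ≤ 1 := by nlinarith
          nlinarith
        have hu1 : 1 ≤ y u := hv1.trans h1
        obtain ⟨i, hi1, hi2⟩ := exists_nat_pow_near hu1 (one_lt_two : (1 : ℝ) < 2)
        obtain ⟨j, hj1, hj2⟩ := exists_nat_pow_near hv1 (one_lt_two : (1 : ℝ) < 2)
        have hiK : i < K := (pow_lt_pow_iff_right₀ (one_lt_two : (1 : ℝ) < 2)).1
          (hi1.trans_lt (hK u))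
        have hji : j ≤ i := by
          have : j < i + 1 := (pow_lt_pow_iff_right₀ (one_lt_two : (1 : ℝ) < 2)).1
            ((hj1.trans h1).trans_lt hi2)
          omega
        have hprod : y u * y v ≤ 4 * (2 ^ i * 2 ^ j) := by
          calc y u * y v ≤ 2 ^ (i + 1) * 2 ^ (j + 1) := by gcongr
            _ = 4 * (2 ^ i * 2 ^ j) := by ring
        have hcij : c i j := by
          refine ⟨hji, ?_, h2.le.trans hprod⟩
          calc (2 : ℝ) ^ i ≤ √d * y v := hi1.trans h3
            _ ≤ √d * 2 ^ (j + 1) := by gcongr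
            _ = 2 * √d * 2 ^ j := by ring
        calc E u v * (y u * y v) ≤ 4 * (2 ^ i * 2 ^ j) * E u v := by
              rw [mul_comm]
              exact mul_le_mul_of_nonneg_right hprod (hE0 u v)
          _ = if c i j then 4 * (2 ^ i * 2 ^ j) *
              (if u ∈ U i then if v ∈ U j then E u v else 0 else 0) else 0 := by
            rw [if_pos hcij, if_pos (by simpa [hU] using hi1), if_pos (by simpa [hU] using hj1)]
          _ ≤ ∑ j ∈ range K, (if c i j then 4 * (2 ^ i * 2 ^ j) *
              (if u ∈ U i then if v ∈ U j then E u v else 0 else 0) else 0) :=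
            single_le_sum (f := fun j => (if c i j then 4 * (2 ^ i * 2 ^ j) *
              (if u ∈ U i then if v ∈ U j then E u v else 0 else 0) else (0 : ℝ)))
              (fun j _ => hnn i j) (mem_range.2 (hji.trans_lt hiK))
          _ ≤ _ := single_le_sum (f := fun i => ∑ j ∈ range K, (if c i j then 4 * (2 ^ i * 2 ^ j) *
              (if u ∈ U i then if v ∈ U j then E u v else 0 else 0) else (0 : ℝ)))
              (fun i _ => sum_nonneg fun j _ => hnn i j) (mem_range.2 hiK)
    · linarith
    · linarith
  have hdegsum : ∑ u, ∑ v, E u v * (y u ^ 2 / √d) ≤ 20 * √d * N := by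
    calc _ = ∑ u, (∑ v, E u v) * (y u ^ 2 / √d) := by simp only [sum_mul]
      _ ≤ ∑ u, 20 * √d * y u ^ 2 := by
        refine sum_le_sum fun u _ => ?_
        by_cases hu : y u = 0
        · simp [hu]
        · calc (∑ v, E u v) * (y u ^ 2 / √d) ≤ 20 * (√d * √d) * (y u ^ 2 / √d) := by
                rw [hss]; gcongr; exact hdeg u hu
            _ = 20 * √d * y u ^ 2 := by field_simp
      _ = 20 * √d * ∑ u, y u ^ 2 := by rw [mul_sum]
      _ ≤ 20 * √d * N := by gcongr
  have hswap : ∑ u, ∑ v, ∑ i ∈ range K, ∑ j ∈ range K, (if c i j then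
        4 * (2 ^ i * 2 ^ j) * (if u ∈ U i then if v ∈ U j then E u v else 0 else 0)
          else (0 : ℝ)) =
      ∑ i ∈ range K, ∑ j ∈ range K, if c i j then
        4 * (2 ^ i * 2 ^ j) * ∑ u ∈ U i, ∑ v ∈ U j, E u v else 0 := by
    simp_rw [sum_comm (s := (univ : Finset V)) (t := range K)]
    refine sum_congr rfl fun i _ => sum_congr rfl fun j _ => ?_
    split_ifs
    · simp_rw [← mul_sum]
      congr 1
      have : ∀ u, ∑ v, (if u ∈ U i then if v ∈ U j then E u v else 0 else 0) =
          if u ∈ U i then ∑ v ∈ U j, E u v else 0 := fun u => by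
        split_ifs
        · rw [sum_ite_mem, univ_inter]
        · simp
      simp_rw [this, sum_ite_mem, univ_inter]
    · simp
  calc _ ≤ 2 * ∑ u, ∑ v, (if y v ≤ y u then
        (if √d < y u * y v then E u v * (y u * y v) else 0) else 0) := by
        refine sum_le_two_mul_sum_of_symm _ y (fun u v => ?_) fun u v => ?_
        · have := hE0 u v
          have := hy0 u
          have := hy0 v
          split_ifs <;> positivity
        · rw [mul_comm (y v), hEs v]
    _ ≤ 2 * ∑ u, ∑ v, (E u v * (y u ^ 2 / √d) + ∑ i ∈ range K, ∑ j ∈ range K, (if c i j then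
        4 * (2 ^ i * 2 ^ j) * (if u ∈ U i then if v ∈ U j then E u v else 0 else 0) else 0)) := by
      gcongr with u _ v _
      exact hpoint u v
    _ = 2 * (∑ u, ∑ v, E u v * (y u ^ 2 / √d) + ∑ i ∈ range K, ∑ j ∈ range K, if c i j then
        4 * (2 ^ i * 2 ^ j) * ∑ u ∈ U i, ∑ v ∈ U j, E u v else 0) := by
      rw [← hswap]
      simp only [sum_add_distrib]
    _ ≤ 2 * (20 * √d * N + 9000 * √d * N) := by gcongr
    _ = 18040 * √d * N := by ring

end Heavy

/-! ### From lattice vectors to all vectors -/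

section Net

variable {V : Type*} [Fintype V]

/-- The quadratic form of the matrix `M`. -/
def quadForm (M : V → V → ℝ) (x : V → ℝ) : ℝ := ∑ u, ∑ v, M u v * (x u * x v)

lemma quadForm_smul (M : V → V → ℝ) (c : ℝ) (x : V → ℝ) :
    quadForm M (fun u => c * x u) = c ^ 2 * quadForm M x := by
  simp only [quadForm, mul_sum]
  exact sum_congr rfl fun u _ => sum_congr rfl fun v _ => by ring

/-- Polarization without symmetry of `M`. The factor `4` balances a vector `x` of norm up to `1`
against a rounding error `r` of norm up to `1/4`. -/
lemma quadForm_add (M : V → V → ℝ) (x r : V → ℝ) :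
    8 * (quadForm M (fun u => x u + r u) - quadForm M x - quadForm M r) =
      quadForm M (fun u => x u + 4 * r u) - quadForm M (fun u => x u - 4 * r u) := by
  simp only [quadForm, mul_sum, ← sum_sub_distrib]
  exact sum_congr rfl fun u _ => sum_congr rfl fun v _ => by ring

lemma exists_quadForm_bound (M : V → V → ℝ) :
    ∃ x₀ : V → ℝ, ∑ u, x₀ u ^ 2 ≤ 1 ∧
      ∀ x : V → ℝ, |quadForm M x| ≤ |quadForm M x₀| * ∑ u, x u ^ 2 := by
  set B : Set (V → ℝ) := {x | ∑ u, x u ^ 2 ≤ 1} with hB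
  have hcompact : IsCompact B := by
    refine (isCompact_univ_pi fun _ : V => isCompact_Icc (a := (-1 : ℝ)) (b := 1)).of_isClosed_subset
      (isClosed_le (by fun_prop) continuous_const) ?_
    intro x hx u _
    have h1 : x u ^ 2 ≤ 1 :=
      (single_le_sum (f := fun u => x u ^ 2) (fun _ _ => sq_nonneg _) (mem_univ u)).trans hx
    exact abs_le.1 ((sq_le_one_iff_abs_le_one _).1 h1)
  obtain ⟨x₀, hx₀, hmax⟩ := hcompact.exists_isMaxOn (f := fun x => |quadForm M x|)
    ⟨0, by simp [hB]⟩ (by unfold quadForm; fun_prop)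
  refine ⟨x₀, hx₀, fun x => ?_⟩
  set S := ∑ u, x u ^ 2 with hS
  rcases (sum_nonneg fun u _ => sq_nonneg (x u) : 0 ≤ S).eq_or_lt with h | h
  · have hx : ∀ u, x u = 0 := fun u => by
      have := (sum_eq_zero_iff_of_nonneg fun u _ => sq_nonneg (x u)).1 h.symm u (mem_univ u)
      exact pow_eq_zero_iff two_ne_zero |>.1 this
    have h0 : quadForm M x = 0 := by simp [quadForm, hx]
    rw [h0, abs_zero]
    positivity
  · have hs : 0 < √S := Real.sqrt_pos.2 h
    have hss : √S ^ 2 = S := Real.sq_sqrt h.le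
    have hmem : (fun u => (√S)⁻¹ * x u) ∈ B := by
      simp only [hB, Set.mem_ofPred_eq, mul_pow, ← mul_sum, ← hS]
      rw [inv_pow, hss, inv_mul_cancel₀ h.ne']
    have h1 : |quadForm M fun u => (√S)⁻¹ * x u| ≤ |quadForm M x₀| := hmax hmem
    rw [quadForm_smul, inv_pow, hss, abs_mul, abs_of_pos (by positivity)] at h1
    rwa [inv_mul_le_iff₀ h, mul_comm] at h1

/-- Rounding towards zero, so that a rounded vector never leaves the ball. -/
lemma exists_int_near (t : ℝ) : ∃ z : ℤ, (z : ℝ) ^ 2 ≤ t ^ 2 ∧ (t - z) ^ 2 ≤ 1 := by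
  rcases le_total 0 t with h | h
  · refine ⟨⌊t⌋, ?_, ?_⟩
    · have h1 : (0 : ℝ) ≤ ⌊t⌋ := by exact_mod_cast Int.floor_nonneg.2 h
      have h2 := Int.floor_le t
      gcongr
    · have h1 := Int.floor_le t
      have h2 := Int.lt_floor_add_one t
      nlinarith
  · refine ⟨⌈t⌉, ?_, ?_⟩
    · have h1 : ((⌈t⌉ : ℤ) : ℝ) ≤ 0 := by exact_mod_cast Int.ceil_le.2 (by simpa using h)
      have h2 := Int.le_ceil t
      nlinarith
    · have h1 := Int.le_ceil t
      have h2 := Int.ceil_lt_add_one t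
      nlinarith

/-- Round an extremal `x₀` to a lattice vector with error `r`, `|r|² ≤ 1/16`. Polarization gives `m
≤ c + m/16 + 4m/8` for the maximum `m`, so `m ≤ 16c/7`. -/
theorem quadForm_le_of_lattice [Nonempty V] [DecidableEq V] (M : V → V → ℝ) {c : ℝ}
    (h : ∀ z ∈ latticeBall V, |quadForm M (scaled z)| ≤ c) (x : V → ℝ) :
    |quadForm M x| ≤ 3 * c * ∑ u, x u ^ 2 := by
  have hN : (0 : ℝ) < Fintype.card V := by exact_mod_cast Fintype.card_pos
  have hc : 0 ≤ c := (abs_nonneg _).trans (h 0 (by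
    rw [mem_latticeBall]
    simp only [Pi.zero_apply, Int.cast_zero, ne_eq, OfNat.ofNat_ne_zero, not_false_eq_true,
      zero_pow, sum_const_zero]
    positivity))
  obtain ⟨x₀, hx₀, hmax⟩ := exists_quadForm_bound M
  set m := |quadForm M x₀| with hm
  have hm0 : 0 ≤ m := abs_nonneg _
  suffices hmc : m ≤ 3 * c from
    (hmax x).trans (mul_le_mul_of_nonneg_right hmc (sum_nonneg fun _ _ => sq_nonneg _))
  set D : ℝ := 4 * √(Fintype.card V) with hD
  have hD0 : 0 < D := by positivity
  have hD2 : D ^ 2 = 16 * Fintype.card V := by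
    rw [hD, mul_pow, Real.sq_sqrt hN.le]; norm_num
  choose z hz1 hz2 using fun u => exists_int_near (D * x₀ u)
  have hzmem : z ∈ latticeBall V := by
    rw [mem_latticeBall]
    calc ∑ u, (z u : ℝ) ^ 2 ≤ ∑ u, D ^ 2 * x₀ u ^ 2 :=
          sum_le_sum fun u _ => (hz1 u).trans (by rw [mul_pow])
      _ = D ^ 2 * ∑ u, x₀ u ^ 2 := by rw [mul_sum]
      _ ≤ D ^ 2 * 1 := by gcongr
      _ = 16 * Fintype.card V := by rw [hD2, mul_one]
  set x' : V → ℝ := scaled z with hx'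
  have hx'1 : ∑ u, x' u ^ 2 ≤ 1 := sum_scaled_sq_le_one hzmem
  set r : V → ℝ := fun u => x₀ u - x' u with hr
  have hr1 : ∑ u, r u ^ 2 ≤ 1 / 16 := by
    have hru : ∀ u, r u ^ 2 ≤ 1 / (16 * Fintype.card V) := fun u => by
      have : r u = (D * x₀ u - z u) / D := by
        simp only [hr, hx', scaled, ← hD]; field_simp
      rw [this, div_pow, hD2]
      gcongr
      exact hz2 u
    calc ∑ u, r u ^ 2 ≤ ∑ _u : V, 1 / (16 * (Fintype.card V : ℝ)) := sum_le_sum fun u _ => hru u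
      _ = 1 / 16 := by
        rw [sum_const, card_univ, nsmul_eq_mul]; field_simp
  have hsum : (fun u => x' u + r u) = x₀ := by
    funext u; simp [hr]
  have hid := quadForm_add M x' r
  rw [hsum] at hid
  have h1 := abs_le.1 (hmax fun u => x' u + 4 * r u)
  have h2 := abs_le.1 (hmax fun u => x' u - 4 * r u)
  have h3 := abs_le.1 (hmax r)
  have h4 := abs_le.1 (h z hzmem)
  have h5 : ∑ u, (x' u + 4 * r u) ^ 2 + ∑ u, (x' u - 4 * r u) ^ 2 =
      2 * ∑ u, x' u ^ 2 + 32 * ∑ u, r u ^ 2 := by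
    simp only [mul_sum, ← sum_add_distrib]
    exact sum_congr rfl fun u _ => by ring
  have h6 : m * ∑ u, (x' u + 4 * r u) ^ 2 + m * ∑ u, (x' u - 4 * r u) ^ 2 ≤ 4 * m := by
    rw [← mul_add, h5]; nlinarith
  have h7 : m * ∑ u, r u ^ 2 ≤ m / 16 := by nlinarith
  have h8 : m ≤ c + 9 / 16 * m := by
    rw [hm, abs_le]
    constructor <;> linarith
  linarith

end Net

/-! ### The norm of the trimmed noise -/

section Concentration

variable {V : Type*} [Fintype V] [DecidableEq V]

open Classical in
/-- The vertices of degree at most `20 * d`. -/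
def lowDegree (d : ℝ) (ω : Sym2 V → Prop) : Finset V :=
  univ.filter fun u => ∑ v, edge ω u v ≤ 20 * d

/-- The centered adjacency matrix, restricted to the vertices of low degree. -/
def trimmedNoise (d : ℝ) (p : Sym2 V → unitInterval) (ω : Sym2 V → Prop) (u v : V) : ℝ :=
  if u ∈ lowDegree d ω ∧ v ∈ lowDegree d ω then edge ω u v - meanEdge p u v else 0

/-- At a lattice vector the light pairs contribute `40√d`, the heavy edges `18040√d` and the heavy
part of the mean `2√d`. Passing to all vectors costs a factor `3`. -/
theorem IsRegular.abs_quadForm_trimmedNoise_le [Nonempty V] {d : ℝ} {p : Sym2 V → unitInterval}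
    {B : Finset V} {ω : Sym2 V → Prop} (hd : 1 ≤ d)
    (hp : ∀ e, (p e : ℝ) ≤ 2 * d / Fintype.card V) (hω : IsRegular d p B ω) (x : V → ℝ) :
    |quadForm (trimmedNoise d p ω) x| ≤ 54246 * √d * ∑ u, x u ^ 2 := by
  have hs : 1 ≤ √d := Real.one_le_sqrt.2 hd
  have hs0 : 0 < √d := by linarith
  have hss : √d * √d = d := Real.mul_self_sqrt (by linarith)
  have hN : (0 : ℝ) < Fintype.card V := by exact_mod_cast Fintype.card_pos
  have hlattice : ∀ z ∈ latticeBall V, |quadForm (trimmedNoise d p ω) (scaled z)| ≤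
      18082 * √d := by
    intro z hz
    -- Trimming the matrix amounts to zeroing coordinates of `z`, and the result is again in the
    -- lattice ball. So the random trimming needs no union bound of its own.
    set z' : V → ℤ := fun u => if u ∈ lowDegree d ω then z u else 0 with hz'
    have hz'mem : z' ∈ latticeBall V := by
      rw [mem_latticeBall] at hz ⊢
      refine le_trans (sum_le_sum fun u _ => ?_) hz
      simp only [hz']
      split_ifs
      · exact le_rfl
      · simpa using sq_nonneg (z u : ℝ)
    set N : ℝ := ((Fintype.card V : ℕ) : ℝ) with hNdef
    set y : V → ℝ := scaled z' with hy
    have hy1 : ∑ u, y u ^ 2 ≤ 1 := sum_scaled_sq_le_one hz'mem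
    have hyz : ∀ u, y u = if u ∈ lowDegree d ω then scaled z u else 0 := fun u => by
      simp only [hy, hz', scaled]; split_ifs <;> simp
    set heavy : ℝ := ∑ u, ∑ v, if √d / N < |y u * y v| then
      (edge ω u v - meanEdge p u v) * (y u * y v) else 0 with hheavy
    have hsplit : quadForm (trimmedNoise d p ω) (scaled z) = lightForm d p ω y + heavy := by
      simp only [quadForm, lightForm, hheavy, ← sum_add_distrib, trimmedNoise]
      refine sum_congr rfl fun u _ => sum_congr rfl fun v _ => ?_
      have : (if u ∈ lowDegree d ω ∧ v ∈ lowDegree d ω then edge ω u v - meanEdge p u v else 0) *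
          (scaled z u * scaled z v) = (edge ω u v - meanEdge p u v) * (y u * y v) := by
        rw [hyz, hyz]
        split_ifs <;> simp_all
      rw [this]
      by_cases h : |y u * y v| ≤ √d / N
      · rw [if_pos h, if_neg (not_lt.2 h)]; ring
      · rw [if_neg h, if_pos (not_le.1 h)]; ring
    have hedge : ∑ u, ∑ v, (if √d / N < |y u * y v| then edge ω u v * |y u * y v| else 0) ≤
        18040 * √d := by
      have hsN : 0 < √N := Real.sqrt_pos.2 hN
      have hssN : √N * √N = N := Real.mul_self_sqrt hN.le
      have key := heavy_sum_le hd (edge ω) (edge_nonneg ω) (edge_comm ω) hω.discrepancy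
        (fun u => √N * |y u|) (fun u => by positivity) (by
          simp only [mul_pow, sq_abs, ← mul_sum]
          rw [sq, hssN]
          nlinarith) (fun u hu => by
          have hyu : y u ≠ 0 := fun h => hu (by simp [h])
          have hmem : u ∈ lowDegree d ω := by
            by_contra hmem
            exact hyu (by rw [hyz, if_neg hmem])
          simpa [lowDegree] using hmem)
      have heq : ∑ u, ∑ v, (if √d < √N * |y u| * (√N * |y v|) then
          edge ω u v * (√N * |y u| * (√N * |y v|)) else 0) =
          N * ∑ u, ∑ v, (if √d / N < |y u * y v| then edge ω u v * |y u * y v| else 0) := by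
        simp only [mul_sum]
        refine sum_congr rfl fun u _ => sum_congr rfl fun v _ => ?_
        have h1 : √N * |y u| * (√N * |y v|) = N * |y u * y v| := by
          rw [abs_mul]
          calc √N * |y u| * (√N * |y v|) = √N * √N * (|y u| * |y v|) := by ring
            _ = _ := by rw [hssN]
        simp only [h1, div_lt_iff₀ hN, mul_comm N |y u * y v|]
        split_ifs <;> ring
      rw [heq] at key
      refine le_of_mul_le_mul_left ?_ hN
      linarith
    have hmean : ∑ u, ∑ v, (if √d / N < |y u * y v| then meanEdge p u v * |y u * y v| else 0) ≤
        2 * √d := by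
      calc _ ≤ ∑ u, ∑ v, 2 * √d * (y u ^ 2 * y v ^ 2) := by
            refine sum_le_sum fun u _ => sum_le_sum fun v _ => ?_
            split_ifs with h
            · have h1 : meanEdge p u v ≤ 2 * d / N := by
                unfold meanEdge
                split_ifs
                · positivity
                · exact hp _
              rw [div_lt_iff₀ hN] at h
              -- On a heavy pair the extra factor is at least `1`; it makes the bound quadratic in
              -- the product, hence summable.
              have h2 : |y u * y v| ≤ |y u * y v| * (|y u * y v| * N / √d) := by
                refine le_mul_of_one_le_right (abs_nonneg _) ?_
                rw [one_le_div hs0]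
                exact h.le
              calc meanEdge p u v * |y u * y v|
                  ≤ 2 * d / N * (|y u * y v| * (|y u * y v| * N / √d)) := by gcongr
                _ = 2 * √d * |y u * y v| ^ 2 := by
                  nth_rw 1 [← hss]; field_simp
                _ = 2 * √d * (y u ^ 2 * y v ^ 2) := by rw [sq_abs, mul_pow]
            · positivity
        _ = 2 * √d * ((∑ u, y u ^ 2) * ∑ v, y v ^ 2) := by
          rw [sum_mul_sum, mul_sum]
          simp only [mul_sum]
        _ ≤ 2 * √d * 1 := by
          gcongr
          have h0 : 0 ≤ ∑ u, y u ^ 2 := sum_nonneg fun _ _ => sq_nonneg _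
          nlinarith
        _ = 2 * √d := mul_one _
    have hheavy_le : |heavy| ≤ 18040 * √d + 2 * √d := by
      calc |heavy| ≤ ∑ u, ∑ v, ((if √d / N < |y u * y v| then edge ω u v * |y u * y v| else 0) +
            (if √d / N < |y u * y v| then meanEdge p u v * |y u * y v| else 0)) := by
            refine (abs_sum_le_sum_abs _ _).trans (sum_le_sum fun u _ =>
              (abs_sum_le_sum_abs _ _).trans (sum_le_sum fun v _ => ?_))
            split_ifs
            · rw [abs_mul, ← add_mul]
              gcongr
              have h1 := edge_nonneg ω u v
              have h2 := meanEdge_nonneg p u v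
              rw [abs_le]
              constructor <;> linarith
            · simp
        _ ≤ _ := by
          simp only [sum_add_distrib]
          exact add_le_add hedge hmean
    rw [hsplit]
    have := abs_add_le (lightForm d p ω y) heavy
    have := hω.light z' hz'mem
    linarith
  refine (quadForm_le_of_lattice _ hlattice x).trans (le_of_eq ?_)
  ring

end Concentration

/-! ### The span of two top eigenvectors -/

section TopTwo

variable {E : Type*} [NormedAddCommGroup E] [InnerProductSpace ℝ E]

lemma inner_sq_add_inner_sq_le {f g : E} (hf : ‖f‖ = 1) (hg : ‖g‖ = 1) (hfg : inner ℝ f g = 0)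
    (u : E) : inner ℝ u f ^ 2 + inner ℝ u g ^ 2 ≤ ‖u‖ ^ 2 := by
  have h := real_inner_self_nonneg (x := u - (inner ℝ u f • f + inner ℝ u g • g))
  have hgf : inner ℝ g f = 0 := by rw [real_inner_comm, hfg]
  simp only [inner_sub_left, inner_sub_right, inner_add_left, inner_add_right,
    real_inner_smul_left, real_inner_smul_right, real_inner_self_eq_norm_sq, hf, hg, hfg, hgf,
    real_inner_comm u f, real_inner_comm u g, norm_smul, Real.norm_eq_abs, mul_pow, sq_abs] at h
  nlinarith

variable {N : ℕ} {T : E →ₗ[ℝ] E} {lam : Fin N → ℝ} {u : OrthonormalBasis (Fin N) ℝ E}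

lemma inner_map_self_eq_sum (hT : ∀ k, T (u k) = lam k • u k) (x : E) :
    inner ℝ x (T x) = ∑ k, lam k * inner ℝ (u k) x ^ 2 := by
  have h : T x = ∑ k, inner ℝ (u k) x • lam k • u k := by
    conv_lhs => rw [← u.sum_repr' x]
    simp only [map_sum, map_smul, hT]
  rw [h, inner_sum]
  refine sum_congr rfl fun k _ => ?_
  rw [real_inner_smul_right, real_inner_smul_right, real_inner_comm]
  ring

/-- Ky Fan's principle for pairs: the weights `c k` lie in `[0, 1]` by Bessel and sum to `2`, so the
weighted sum of eigenvalues is largest when they sit on the top two. After subtracting `lam i₁`,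
only `i₀` can contribute positively. -/
theorem inner_map_add_inner_map_le (hlam : Antitone lam) (hT : ∀ k, T (u k) = lam k • u k)
    {i₀ i₁ : Fin N} (h0 : (i₀ : ℕ) = 0) (h1 : (i₁ : ℕ) = 1) {f g : E} (hf : ‖f‖ = 1)
    (hg : ‖g‖ = 1) (hfg : inner ℝ f g = 0) :
    inner ℝ f (T f) + inner ℝ g (T g) ≤ lam i₀ + lam i₁ := by
  set c : Fin N → ℝ := fun k => inner ℝ (u k) f ^ 2 + inner ℝ (u k) g ^ 2 with hc
  have hc1 : ∀ k, c k ≤ 1 := fun k => by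
    have := inner_sq_add_inner_sq_le hf hg hfg (u k)
    rwa [u.norm_eq_one, one_pow] at this
  have hc0 : ∀ k, 0 ≤ c k := fun k => by simp only [hc]; positivity
  have hcsum : ∑ k, c k = 2 := by
    simp only [hc, sum_add_distrib]
    have h2 : ∀ x : E, ∑ k, inner ℝ (u k) x ^ 2 = ‖x‖ ^ 2 := fun x => by
      rw [← u.sum_sq_norm_inner_right x]
      simp
    rw [h2, h2, hf, hg]
    norm_num
  have hne : i₀ ≠ i₁ := fun h => by rw [h, h1] at h0; exact one_ne_zero h0
  have hle : lam i₁ ≤ lam i₀ := hlam (by rw [Fin.le_def]; omega)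
  have hterm : ∀ k, (lam k - lam i₁) * c k ≤ if k = i₀ then lam i₀ - lam i₁ else 0 := by
    intro k
    split_ifs with hk
    · subst hk
      exact mul_le_of_le_one_right (by linarith) (hc1 _)
    · have hk0 : (k : ℕ) ≠ 0 := fun h => hk (Fin.ext (by omega))
      have : lam k ≤ lam i₁ := hlam (by rw [Fin.le_def]; omega)
      exact mul_nonpos_of_nonpos_of_nonneg (by linarith) (hc0 k)
  have hsum : ∑ k, (lam k - lam i₁) * c k ≤ lam i₀ - lam i₁ :=
    (sum_le_sum fun k _ => hterm k).trans (by simp)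
  rw [inner_map_self_eq_sum hT, inner_map_self_eq_sum hT, ← sum_add_distrib]
  have : ∑ k, (lam k - lam i₁) * c k =
      ∑ k, (lam k * inner ℝ (u k) f ^ 2 + lam k * inner ℝ (u k) g ^ 2) - lam i₁ * ∑ k, c k := by
    rw [mul_sum, ← sum_sub_distrib]
    exact sum_congr rfl fun k _ => by simp only [hc]; ring
  rw [hcsum] at this
  linarith

lemma inner_map_comb_of_eigen (hT : ∀ k, T (u k) = lam k • u k) {i₀ i₁ : Fin N} (hne : i₀ ≠ i₁)
    (α β : ℝ) : inner ℝ (α • u i₀ + β • u i₁) (T (α • u i₀ + β • u i₁)) =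
      α ^ 2 * lam i₀ + β ^ 2 * lam i₁ := by
  have h01 : inner ℝ (u i₀) (u i₁) = 0 := u.inner_eq_zero hne
  have h10 : inner ℝ (u i₁) (u i₀) = 0 := u.inner_eq_zero hne.symm
  simp only [map_add, map_smul, hT, inner_add_left, inner_add_right, real_inner_smul_left,
    real_inner_smul_right, h01, h10, real_inner_self_eq_norm_sq, u.norm_eq_one]
  ring

lemma norm_sq_comb {i₀ i₁ : Fin N} (u : OrthonormalBasis (Fin N) ℝ E) (hne : i₀ ≠ i₁) (α β : ℝ) :
    ‖α • u i₀ + β • u i₁‖ ^ 2 = α ^ 2 + β ^ 2 := by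
  have h01 : inner ℝ (u i₀) (u i₁) = 0 := u.inner_eq_zero hne
  have h10 : inner ℝ (u i₁) (u i₀) = 0 := u.inner_eq_zero hne.symm
  rw [← real_inner_self_eq_norm_sq]
  simp only [inner_add_left, inner_add_right, real_inner_smul_left,
    real_inner_smul_right, h01, h10, real_inner_self_eq_norm_sq, u.norm_eq_one, norm_smul,
    Real.norm_eq_abs, mul_pow, sq_abs]
  ring

omit [NormedAddCommGroup E] [InnerProductSpace ℝ E] in
lemma image_lt_two (φ : Fin N → E) {i₀ i₁ : Fin N} (h0 : (i₀ : ℕ) = 0) (h1 : (i₁ : ℕ) = 1) :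
    φ '' {k | (k : ℕ) < 2} = {φ i₀, φ i₁} := by
  have : {k : Fin N | (k : ℕ) < 2} = {i₀, i₁} := by
    ext k
    simp only [Set.mem_ofPred_eq, Set.mem_insert_iff, Set.mem_singleton_iff, Fin.ext_iff]
    omega
  rw [this, Set.image_pair]

end TopTwo

/-! ### The top-two eigenspace of a matrix and existence of an output -/

section Matrix

variable {N : ℕ}

lemma inner_toEuclideanLin (A : Matrix (Fin N) (Fin N) ℝ) (x : EuclideanSpace ℝ (Fin N)) :
    inner ℝ x (Matrix.toEuclideanLin A x) = quadForm A x := by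
  simp only [PiLp.inner_apply, quadForm, Matrix.toLpLin_apply, Matrix.mulVec, dotProduct]
  refine sum_congr rfl fun i _ => ?_
  simp only [RCLike.inner_apply, conj_trivial, sum_mul]
  exact sum_congr rfl fun j _ => by ring

/-- A unit vector `v` in the span `W` of two top eigenvectors has a companion `w` such that the
two together maximize the sum of the quadratic form over orthonormal pairs. -/
theorem IsTopTwoEigenspace.exists_companion {A : Matrix (Fin N) (Fin N) ℝ}
    {W : Submodule ℝ (EuclideanSpace ℝ (Fin N))} (hN : 2 ≤ N) (hW : IsTopTwoEigenspace A W)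
    {v : EuclideanSpace ℝ (Fin N)} (hv : v ∈ W) (hv1 : ‖v‖ = 1) :
    ∃ w : EuclideanSpace ℝ (Fin N), ‖w‖ = 1 ∧ ∀ f g : EuclideanSpace ℝ (Fin N),
      ‖f‖ = 1 → ‖g‖ = 1 → inner ℝ f g = 0 →
        quadForm A f + quadForm A g ≤ quadForm A w + quadForm A v := by
  obtain ⟨lam, u, hlam, hT, rfl⟩ := hW
  set i₀ : Fin N := ⟨0, by omega⟩
  set i₁ : Fin N := ⟨1, by omega⟩
  have hne : i₀ ≠ i₁ := by simp [i₀, i₁]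
  rw [image_lt_two u (i₀ := i₀) (i₁ := i₁) rfl rfl, Submodule.mem_span_pair] at hv
  obtain ⟨α, β, rfl⟩ := hv
  have hαβ : α ^ 2 + β ^ 2 = 1 := by rw [← norm_sq_comb u hne, hv1, one_pow]
  -- The quarter turn of `v` within the plane; the two forms then add up to the trace `lam i₀ + lam
  -- i₁`.
  refine ⟨(-β) • u i₀ + α • u i₁, ?_, fun f g hf hg hfg => ?_⟩
  · have := norm_sq_comb u hne (-β) α
    rw [neg_sq, add_comm (β ^ 2), hαβ] at this
    exact (pow_eq_one_iff_of_nonneg (norm_nonneg _) two_ne_zero).1 this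
  · have h := inner_map_add_inner_map_le hlam hT (i₀ := i₀) (i₁ := i₁) rfl rfl hf hg hfg
    have h1 := inner_map_comb_of_eigen hT hne (-β) α
    have h2 := inner_map_comb_of_eigen hT hne α β
    rw [inner_toEuclideanLin] at h1 h2
    rw [inner_toEuclideanLin, inner_toEuclideanLin] at h
    rw [h1, h2]
    refine h.trans (le_of_eq ?_)
    linear_combination (-(lam i₀ + lam i₁)) * hαβ

theorem exists_isTopTwoEigenspace {A : Matrix (Fin N) (Fin N) ℝ} (hA : A.IsHermitian) :
    ∃ W, IsTopTwoEigenspace A W := by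
  have hT := Matrix.isSymmetric_toEuclideanLin_iff.2 hA
  have hn : Module.finrank ℝ (EuclideanSpace ℝ (Fin N)) = N := finrank_euclideanSpace_fin
  exact ⟨_, hT.eigenvalues hn, hT.eigenvectorBasis hn, hT.eigenvalues_antitone hn,
    fun k => hT.apply_eigenvectorBasis hn k, rfl⟩

lemma exists_unit_orthogonal (α β : ℝ) : ∃ p q : ℝ, p ^ 2 + q ^ 2 = 1 ∧ α * p + β * q = 0 := by
  rcases (add_nonneg (sq_nonneg α) (sq_nonneg β)).eq_or_lt with h | h
  · have h1 : α = 0 := by nlinarith [sq_nonneg α, sq_nonneg β]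
    have h2 : β = 0 := by nlinarith [sq_nonneg α, sq_nonneg β]
    exact ⟨1, 0, by norm_num, by rw [h1, h2]; ring⟩
  · have hs : √(α ^ 2 + β ^ 2) ≠ 0 := (Real.sqrt_pos.2 h).ne'
    have hss : √(α ^ 2 + β ^ 2) ^ 2 = α ^ 2 + β ^ 2 := Real.sq_sqrt h.le
    refine ⟨-β / √(α ^ 2 + β ^ 2), α / √(α ^ 2 + β ^ 2), ?_, by ring⟩
    rw [div_pow, div_pow, hss, neg_sq, ← add_div, add_comm (β ^ 2), div_self h.ne']

/-- The projection `v₁` may vanish; then every unit vector of the plane qualifies. -/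
lemma exists_unit_orthogonal_mem {A : Matrix (Fin N) (Fin N) ℝ} (hN : 2 ≤ N)
    {W : Submodule ℝ (EuclideanSpace ℝ (Fin N))} (hW : IsTopTwoEigenspace A W)
    {v₁ : EuclideanSpace ℝ (Fin N)} (hv₁ : v₁ ∈ W) :
    ∃ v₂ ∈ W, ‖v₂‖ = 1 ∧ inner ℝ v₁ v₂ = 0 := by
  obtain ⟨lam, u, hlam, hT, rfl⟩ := hW
  set i₀ : Fin N := ⟨0, by omega⟩
  set i₁ : Fin N := ⟨1, by omega⟩
  have hne : i₀ ≠ i₁ := by simp [i₀, i₁]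
  rw [image_lt_two u (i₀ := i₀) (i₁ := i₁) rfl rfl] at hv₁ ⊢
  obtain ⟨α, β, rfl⟩ := Submodule.mem_span_pair.1 hv₁
  obtain ⟨p, q, hpq, h⟩ := exists_unit_orthogonal α β
  refine ⟨p • u i₀ + q • u i₁, Submodule.mem_span_pair.2 ⟨p, q, rfl⟩, ?_, ?_⟩
  · have := norm_sq_comb u hne p q
    rw [hpq] at this
    exact (pow_eq_one_iff_of_nonneg (norm_nonneg _) two_ne_zero).1 this
  · have h01 : inner ℝ (u i₀) (u i₁) = 0 := u.inner_eq_zero hne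
    have h10 : inner ℝ (u i₁) (u i₀) = 0 := u.inner_eq_zero hne.symm
    simp only [inner_add_left, inner_add_right, real_inner_smul_left,
      real_inner_smul_right, h01, h10, real_inner_self_eq_norm_sq, u.norm_eq_one]
    linear_combination h

lemma isHermitian_zeroOut {A₀ : Matrix (Fin N) (Fin N) ℝ} (hA : A₀.IsHermitian) (d : ℝ) :
    (zeroOut A₀ d).IsHermitian := by
  ext i j
  have h : A₀ j i = A₀ i j := by simpa using hA.apply i j
  simp only [zeroOut, Matrix.conjTranspose_apply, Matrix.of_apply, star_trivial, h, or_comm]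

theorem exists_isSpectralPartitionOutput {n : ℕ} (hn : 1 ≤ n)
    {A₀ : Matrix (Fin (2 * n)) (Fin (2 * n)) ℝ} (hA : A₀.IsHermitian) (d : ℝ) :
    ∃ S T, IsSpectralPartitionOutput n A₀ d S T := by
  obtain ⟨W, hW⟩ := exists_isTopTwoEigenspace (isHermitian_zeroOut hA d)
  obtain ⟨v₂, hv₂⟩ := exists_unit_orthogonal_mem (by omega) hW
    (W.starProjection_apply_mem (WithLp.toLp 2 fun _ => 1))
  refine ⟨_, _, W, _, v₂, Tuple.sort fun k => -v₂ k, hW, rfl, hv₂, fun k l hkl => ?_, rfl, rfl⟩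
  have := Tuple.monotone_sort (fun k => -v₂ k) hkl
  simpa using this

end Matrix

/-! ### Estimates for the block model -/

section Block

variable {V : Type*} [DecidableEq V]

/-- The vector that is `1` on the block `P` and `-1` outside. -/
def blockSign (P : Finset V) (u : V) : ℝ := if u ∈ P then 1 else -1

lemma blockSign_sq (P : Finset V) (u : V) : blockSign P u ^ 2 = 1 := by
  unfold blockSign; split_ifs <;> norm_num

lemma one_add_blockSign_mul (P : Finset V) (u v : V) :
    1 + blockSign P u * blockSign P v = 2 * if (u ∈ P ↔ v ∈ P) then 1 else 0 := by
  unfold blockSign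
  by_cases hu : u ∈ P <;> by_cases hv : v ∈ P <;> norm_num [hu, hv]

variable [Fintype V]

lemma sum_blockSign {P : Finset V} (hP : 2 * #P = Fintype.card V) : ∑ u, blockSign P u = 0 := by
  have h1 : ∀ u, blockSign P u = 2 * (if u ∈ P then 1 else 0) - 1 := fun u => by
    unfold blockSign; split_ifs <;> norm_num
  simp only [h1, sum_sub_distrib, ← mul_sum, sum_ite_mem, univ_inter, sum_const, nsmul_eq_mul,
    mul_one, card_univ]
  have : (2 * #P : ℝ) = Fintype.card V := by exact_mod_cast hP
  linarith

lemma blockSign_compl (P : Finset V) (u : V) : blockSign Pᶜ u = -blockSign P u := by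
  unfold blockSign
  by_cases hu : u ∈ P <;> simp [hu]

/-- Bessel's inequality for `1` and `blockSign P`, which are orthogonal because the blocks have
equal size. -/
lemma sq_sum_add_sq_sum_blockSign_le [Nonempty V] {P : Finset V} (hP : 2 * #P = Fintype.card V)
    (y : V → ℝ) : (∑ u, y u) ^ 2 + (∑ u, blockSign P u * y u) ^ 2 ≤
      Fintype.card V * ∑ u, y u ^ 2 := by
  have hN : (0 : ℝ) < Fintype.card V := by exact_mod_cast Fintype.card_pos
  set N : ℝ := ((Fintype.card V : ℕ) : ℝ) with hNdef
  set s := ∑ u, y u with hs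
  set t := ∑ u, blockSign P u * y u with ht
  have h0 : 0 ≤ ∑ u, (N * y u - s - blockSign P u * t) ^ 2 := sum_nonneg fun _ _ => sq_nonneg _
  have h1 : ∀ u, (N * y u - s - blockSign P u * t) ^ 2 = N ^ 2 * y u ^ 2 - 2 * N * s * y u -
      2 * N * t * (blockSign P u * y u) + (s ^ 2 + t ^ 2) + 2 * s * t * blockSign P u := fun u => by
    linear_combination t ^ 2 * blockSign_sq P u
  simp only [h1, sum_add_distrib, sum_sub_distrib, ← mul_sum, sum_blockSign hP, ← hs, ← ht,
    sum_const, card_univ, nsmul_eq_mul, ← hNdef] at h0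
  have h2 : 0 ≤ N * (N * ∑ u, y u ^ 2 - (s ^ 2 + t ^ 2)) := by linarith
  have := nonneg_of_mul_nonneg_right h2 hN
  linarith

/-- `p` is the family of edge probabilities of the block model with the average degrees `a` and `b`
inside and between the blocks `P` and `Pᶜ`. -/
def IsBlockProb (a b : ℝ) (P : Finset V) (p : Sym2 V → unitInterval) : Prop :=
  ∀ u v, (p s(u, v) : ℝ) = (a + b + (a - b) * (blockSign P u * blockSign P v)) / Fintype.card V

variable {a b : ℝ} {P : Finset V} {p : Sym2 V → unitInterval}

lemma IsBlockProb.le (hp : IsBlockProb a b P p) (hb : 0 ≤ b) (hab : b ≤ a) (e : Sym2 V) :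
    (p e : ℝ) ≤ 2 * (a + b) / Fintype.card V := by
  induction e using Sym2.ind with
  | _ u v =>
    rw [hp u v]
    gcongr
    have h := one_add_blockSign_mul P u v
    split_ifs at h <;> nlinarith

lemma IsBlockProb.meanEdge_le (hp : IsBlockProb a b P p) (u v : V) :
    meanEdge p u v ≤
      (a + b + (a - b) * (blockSign P u * blockSign P v)) / Fintype.card V := by
  rw [← hp u v]
  unfold meanEdge
  split_ifs
  exacts [(p _).2.1, le_rfl]

lemma IsBlockProb.sum_meanEdge_le [Nonempty V] (hp : IsBlockProb a b P p)
    (hP : 2 * #P = Fintype.card V) (u : V) : ∑ v, meanEdge p u v ≤ a + b := by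
  have hN : (0 : ℝ) < Fintype.card V := by exact_mod_cast Fintype.card_pos
  refine (sum_le_sum fun v _ => hp.meanEdge_le u v).trans (le_of_eq ?_)
  rw [← sum_div]
  simp only [sum_add_distrib, ← mul_sum, sum_blockSign hP, sum_const, card_univ, nsmul_eq_mul]
  field_simp
  ring

/-- The loss `2 * a` comes from the zero diagonal of `meanEdge`. -/
lemma IsBlockProb.le_sum_block [Nonempty V] (hp : IsBlockProb a b P p)
    (hP : 2 * #P = Fintype.card V) :
    a * Fintype.card V - 2 * a ≤
      ∑ u, ∑ v, (if (u ∈ P ↔ v ∈ P) then 1 else 0) * meanEdge p u v := by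
  have hN : (0 : ℝ) < Fintype.card V := by exact_mod_cast Fintype.card_pos
  set N : ℝ := ((Fintype.card V : ℕ) : ℝ) with hNdef
  have hterm : ∀ u v, (if (u ∈ P ↔ v ∈ P) then 1 else 0) * meanEdge p u v =
      (a + a * (blockSign P u * blockSign P v)) / N - if u = v then 2 * a / N else 0 := by
    intro u v
    have h1 := one_add_blockSign_mul P u v
    have h2 := blockSign_sq P u
    have h3 := blockSign_sq P v
    by_cases huv : u = v
    · subst huv
      rw [← sq, h2]
      simp [meanEdge]
      ring
    · have h4 : (if (u ∈ P ↔ v ∈ P) then (1 : ℝ) else 0) =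
          (1 + blockSign P u * blockSign P v) / 2 := by linarith
      rw [h4, meanEdge, if_neg huv, if_neg huv, hp u v, ← hNdef]
      field_simp
      linear_combination (a - b) * blockSign P v ^ 2 * h2 + (a - b) * h3
  simp only [hterm, sum_sub_distrib, sum_ite_eq, mem_univ, if_true, ← sum_div, sum_add_distrib,
    ← mul_sum, sum_blockSign hP, mul_zero, sum_const_zero, sum_const, card_univ, nsmul_eq_mul,
    ← hNdef]
  refine le_of_eq ?_
  field_simp
  ring

/-- The adjacency matrix, restricted to the vertices of low degree. -/
def trimmedEdge (d : ℝ) (ω : Sym2 V → Prop) (u v : V) : ℝ :=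
  if u ∈ lowDegree d ω ∧ v ∈ lowDegree d ω then edge ω u v else 0

variable {ω : Sym2 V → Prop}

/-- A high-degree vertex exceeds its mean degree by at least `19d`, while the total excess over any
set is at most `6√d N`. Thus few vertices are trimmed, and few edges with them. -/
lemma IsRegular.highDegree_le [Nonempty V] (hd : 1 ≤ a + b) (hω : IsRegular (a + b) p P ω)
    (hp : IsBlockProb a b P p) (hP : 2 * #P = Fintype.card V) :
    3 * √(a + b) * #(lowDegree (a + b) ω)ᶜ ≤ Fintype.card V ∧
      ∑ u ∈ (lowDegree (a + b) ω)ᶜ, ∑ v, edge ω u v ≤ 7 * √(a + b) * Fintype.card V := by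
  set d := a + b with hddef
  have hs : 1 ≤ √d := Real.one_le_sqrt.2 hd
  have hss : √d * √d = d := Real.mul_self_sqrt (by linarith)
  have hN : (0 : ℝ) < Fintype.card V := by exact_mod_cast Fintype.card_pos
  set N : ℝ := ((Fintype.card V : ℕ) : ℝ) with hNdef
  set H := (lowDegree d ω)ᶜ with hH
  have h1 : #H * (20 * d) ≤ ∑ u ∈ H, ∑ v, edge ω u v := by
    rw [← nsmul_eq_mul]
    refine card_nsmul_le_sum _ _ _ fun u hu => ?_
    simp only [hH, lowDegree, mem_compl, mem_filter, mem_univ, true_and, not_le] at hu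
    exact hu.le
  have h2 : ∑ u ∈ H, ∑ v, meanEdge p u v ≤ #H * d := by
    rw [← nsmul_eq_mul]
    exact sum_le_card_nsmul _ _ _ fun u _ => hp.sum_meanEdge_le hP u
  have h3 := hω.degrees H
  simp only [sum_sub_distrib, ← hNdef] at h3
  have h4 : √d * (19 * √d * #H) ≤ √d * (6 * N) := by
    calc √d * (19 * √d * #H) = 19 * (√d * √d) * #H := by ring
      _ = 19 * d * #H := by rw [hss]
      _ ≤ √d * (6 * N) := by linarith
  have h5 : 19 * √d * #H ≤ 6 * N := le_of_mul_le_mul_left h4 (by linarith)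
  have h6 : (#H : ℝ) * d ≤ √d * N := by
    calc (#H : ℝ) * d = √d * (√d * #H) := by rw [← mul_assoc, hss, mul_comm]
      _ ≤ √d * N := by gcongr; linarith
  constructor <;> linarith

/-- This is `N` times the value of the ideal pair. Doubling the losses `4√d N` (fluctuation), `2 ·
7√d N` (trimmed edges, in both orders) and `2a ≤ √d N` (diagonal) gives `38√d N`. -/
theorem IsRegular.le_block_trimmedEdge [Nonempty V] (hd : 1 ≤ a + b)
    (hω : IsRegular (a + b) p P ω)
    (hp : IsBlockProb a b P p) (hP : 2 * #P = Fintype.card V) (ha : 2 * a ≤ Fintype.card V) :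
    (2 * a - 38 * √(a + b)) * Fintype.card V ≤
      ∑ u, ∑ v, trimmedEdge (a + b) ω u v * (1 + blockSign P u * blockSign P v) := by
  set d := a + b with hddef
  have hs : 1 ≤ √d := Real.one_le_sqrt.2 hd
  have hN : (0 : ℝ) < Fintype.card V := by exact_mod_cast Fintype.card_pos
  set N : ℝ := ((Fintype.card V : ℕ) : ℝ) with hNdef
  set H := (lowDegree d ω)ᶜ with hH
  have hbad := (hω.highDegree_le hd hp hP).2
  have h1 := hω.block
  have h2 := hp.le_sum_block hP
  simp only [mul_sub, sum_sub_distrib] at h1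
  have h3 : ∑ u, ∑ v, (if (u ∈ P ↔ v ∈ P) then 1 else 0) * edge ω u v ≤
      ∑ u, ∑ v, ((if (u ∈ P ↔ v ∈ P) then 1 else 0) * trimmedEdge d ω u v +
        ((if u ∈ H then edge ω u v else 0) + if v ∈ H then edge ω v u else 0)) := by
    refine sum_le_sum fun u _ => sum_le_sum fun v _ => ?_
    have he := edge_nonneg ω u v
    rw [edge_comm ω v u]
    by_cases hu : u ∈ lowDegree d ω <;> by_cases hv : v ∈ lowDegree d ω <;>
      simp only [trimmedEdge, hH, mem_compl, hu, hv, true_and, false_and, if_true, if_false,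
        not_true_eq_false, not_false_eq_true] <;> split_ifs <;> linarith
  have h4 : ∑ u, ∑ v, (if u ∈ H then edge ω u v else 0) = ∑ u ∈ H, ∑ v, edge ω u v := by
    have hrow : ∀ u, ∑ v, (if u ∈ H then edge ω u v else 0) =
        if u ∈ H then ∑ v, edge ω u v else 0 := fun u => by split_ifs <;> simp
    simp only [hrow, sum_ite_mem, univ_inter]
  have h5 : ∑ u, ∑ v, (if v ∈ H then edge ω v u else 0) = ∑ u ∈ H, ∑ v, edge ω u v := by
    rw [sum_comm, h4]
  simp only [sum_add_distrib, h4, h5] at h3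
  have h6 : ∑ u, ∑ v, trimmedEdge d ω u v * (1 + blockSign P u * blockSign P v) =
      2 * ∑ u, ∑ v, (if (u ∈ P ↔ v ∈ P) then 1 else 0) * trimmedEdge d ω u v := by
    simp only [mul_sum]
    refine sum_congr rfl fun u _ => sum_congr rfl fun v _ => ?_
    rw [one_add_blockSign_mul]
    ring
  rw [h6]
  have h7 : N ≤ √d * N := le_mul_of_one_le_left hN.le hs
  linarith

/-- Noise plus the rank-two mean. The mean has zero diagonal, and filling it in only increases the
form. -/
theorem IsRegular.quadForm_trimmedEdge_le [Nonempty V] (hd : 1 ≤ a + b) (hb : 0 ≤ b) (hab : b ≤ a)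
    (hω : IsRegular (a + b) p P ω) (hp : IsBlockProb a b P p) (x : V → ℝ) :
    quadForm (trimmedEdge (a + b) ω) x ≤ 54246 * √(a + b) * ∑ u, x u ^ 2 +
      ((a + b) * (∑ u ∈ lowDegree (a + b) ω, x u) ^ 2 +
        (a - b) * (∑ u ∈ lowDegree (a + b) ω, blockSign P u * x u) ^ 2) / Fintype.card V := by
  set d := a + b with hddef
  have hN : (0 : ℝ) < Fintype.card V := by exact_mod_cast Fintype.card_pos
  set N : ℝ := ((Fintype.card V : ℕ) : ℝ) with hNdef
  set L := lowDegree d ω with hL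
  set y : V → ℝ := fun u => if u ∈ L then x u else 0 with hy
  have hnoise := (abs_le.1 (hω.abs_quadForm_trimmedNoise_le hd (hp.le hb hab) x)).2
  have hsplit : quadForm (trimmedEdge d ω) x ≤ quadForm (trimmedNoise d p ω) x +
      ∑ u, ∑ v, (d + (a - b) * (blockSign P u * blockSign P v)) / N * (y u * y v) := by
    simp only [quadForm, ← sum_add_distrib]
    refine sum_le_sum fun u _ => sum_le_sum fun v _ => ?_
    by_cases h : u ∈ L ∧ v ∈ L
    · simp only [trimmedEdge, trimmedNoise, ← hL, h, and_self, if_true, hy]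
      have h1 : meanEdge p u v * (x u * x v) ≤
          (d + (a - b) * (blockSign P u * blockSign P v)) / N * (x u * x v) := by
        by_cases huv : u = v
        · subst huv
          exact mul_le_mul_of_nonneg_right (hp.meanEdge_le u u) (mul_self_nonneg _)
        · rw [meanEdge, if_neg huv, hp u v]
      linarith
    · simp only [trimmedEdge, trimmedNoise, ← hL, h, if_false]
      have : y u * y v = 0 := by
        rcases not_and_or.1 h with h | h <;> simp [hy, h]
      rw [this]
      simp
  have hy1 : ∑ u ∈ L, x u = ∑ u, y u := by simp only [hy, sum_ite_mem, univ_inter]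
  have hy2 : ∑ u ∈ L, blockSign P u * x u = ∑ u, blockSign P u * y u := by
    simp only [hy, mul_ite, mul_zero, sum_ite_mem, univ_inter]
  have hmean : ∑ u, ∑ v, (d + (a - b) * (blockSign P u * blockSign P v)) / N * (y u * y v) =
      (d * (∑ u, y u) ^ 2 + (a - b) * (∑ u, blockSign P u * y u) ^ 2) / N := by
    rw [sq, sq, sum_mul_sum, sum_mul_sum, mul_sum, mul_sum, ← sum_add_distrib, sum_div]
    refine sum_congr rfl fun u _ => ?_
    rw [mul_sum, mul_sum, ← sum_add_distrib, sum_div]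
    exact sum_congr rfl fun v _ => by ring
  rw [hy1, hy2]
  linarith

/-- A unit vector `v` orthogonal to the constant vectors that, with some other unit vector, does
at least as well as the ideal pair for the trimmed adjacency matrix is close to the block vector. -/
theorem IsRegular.correlation_le [Nonempty V] (hd : 1 ≤ a + b) (hb : 0 ≤ b) (hab : b ≤ a)
    (hω : IsRegular (a + b) p P ω) (hp : IsBlockProb a b P p) (hP : 2 * #P = Fintype.card V)
    (ha : 2 * a ≤ Fintype.card V) {w v : V → ℝ} (hw : ∑ u, w u ^ 2 = 1) (hv : ∑ u, v u ^ 2 = 1)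
    (hv0 : ∑ u, v u = 0)
    (hmax : (∑ u, ∑ u', trimmedEdge (a + b) ω u u' * (1 + blockSign P u * blockSign P u')) /
        Fintype.card V ≤
      quadForm (trimmedEdge (a + b) ω) w + quadForm (trimmedEdge (a + b) ω) v) :
    (a - b) * (1 - (∑ u ∈ lowDegree (a + b) ω, blockSign P u * v u) ^ 2 / Fintype.card V) ≤
      108531 * √(a + b) := by
  have hlow := hω.le_block_trimmedEdge hd hp hP ha
  have hbad := (hω.highDegree_le hd hp hP).1
  have hup1 := hω.quadForm_trimmedEdge_le hd hb hab hp w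
  have hup2 := hω.quadForm_trimmedEdge_le hd hb hab hp v
  set d := a + b with hddef
  have hs : 1 ≤ √d := Real.one_le_sqrt.2 hd
  have hss : √d * √d = d := Real.mul_self_sqrt (by linarith)
  have hN : (0 : ℝ) < Fintype.card V := by exact_mod_cast Fintype.card_pos
  set N : ℝ := ((Fintype.card V : ℕ) : ℝ) with hNdef
  set L := lowDegree d ω with hL
  set m := (∑ u ∈ L, blockSign P u * v u) ^ 2 with hm
  rw [← le_div_iff₀ hN] at hlow
  -- The companion `w` gets no more than the top mean eigenvalue `d`, by Bessel and `a - b ≤ d`.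
  have h1 : (d * (∑ u ∈ L, w u) ^ 2 + (a - b) * (∑ u ∈ L, blockSign P u * w u) ^ 2) / N ≤ d := by
    rw [div_le_iff₀ hN]
    have h := sq_sum_add_sq_sum_blockSign_le hP fun u => if u ∈ L then w u else 0
    simp only [mul_ite, mul_zero, sum_ite_mem, univ_inter, ite_pow, ne_eq, OfNat.ofNat_ne_zero,
      not_false_eq_true, zero_pow, ← hNdef] at h
    have h2 : ∑ u ∈ L, w u ^ 2 ≤ 1 := by
      rw [← hw]
      exact sum_le_sum_of_subset_of_nonneg (subset_univ _) fun _ _ _ => sq_nonneg _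
    calc d * (∑ u ∈ L, w u) ^ 2 + (a - b) * (∑ u ∈ L, blockSign P u * w u) ^ 2
        ≤ d * (∑ u ∈ L, w u) ^ 2 + d * (∑ u ∈ L, blockSign P u * w u) ^ 2 := by
          gcongr; linarith
      _ = d * ((∑ u ∈ L, w u) ^ 2 + (∑ u ∈ L, blockSign P u * w u) ^ 2) := by ring
      _ ≤ d * (N * 1) := by
          gcongr
          exact h.trans (by gcongr)
      _ = d * N := by ring
  -- As `v` is orthogonal to `1`, its sum over `L` is minus its sum over the few trimmed vertices.
  -- The final constant is `38 + 2 · 54246 + 1`.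
  have h2 : d * (∑ u ∈ L, v u) ^ 2 / N ≤ √d := by
    have h3 : ∑ u ∈ L, v u = -∑ u ∈ Lᶜ, v u := by
      have := sum_add_sum_compl L v
      linarith
    have h4 : (∑ u ∈ L, v u) ^ 2 ≤ #Lᶜ := by
      rw [h3, neg_sq]
      refine (sq_sum_le_card_mul_sum_sq).trans ?_
      refine mul_le_of_le_one_right (by positivity) ?_
      rw [← hv]
      exact sum_le_sum_of_subset_of_nonneg (subset_univ _) fun _ _ _ => sq_nonneg _
    rw [div_le_iff₀ hN]
    calc d * (∑ u ∈ L, v u) ^ 2 ≤ d * #Lᶜ := by gcongr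
      _ = √d * (√d * #Lᶜ) := by rw [← mul_assoc, hss]
      _ ≤ √d * N := by
        gcongr
        have : 0 ≤ √d * (#Lᶜ : ℝ) := by positivity
        linarith
  have h5 : (d * (∑ u ∈ L, v u) ^ 2 + (a - b) * m) / N =
      d * (∑ u ∈ L, v u) ^ 2 / N + (a - b) * (m / N) := by ring
  rw [h5] at hup2
  rw [hw] at hup1
  rw [hv] at hup2
  linarith

/-- If the value of `x` is not larger outside `S` than inside, then `S` contains most of the block
with which `x` correlates positively. -/
theorem card_sub_card_inter_le [Nonempty V] {S L : Finset V} (hP : 2 * #P = Fintype.card V)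
    (hS : 2 * #S = Fintype.card V) {x : V → ℝ} (hx : ∑ u, x u ^ 2 ≤ 1)
    (hxS : ∀ u ∈ S, ∀ v ∉ S, x v ≤ x u) (hc : 0 < ∑ u ∈ L, blockSign P u * x u)
    {η : ℝ} (hη : η ≤ 1 / 2)
    (hm : 1 - η ≤ (∑ u ∈ L, blockSign P u * x u) ^ 2 / Fintype.card V) :
    (#P : ℝ) - #(P ∩ S) ≤ #Lᶜ + 2 * η * Fintype.card V := by
  have hN : (0 : ℝ) < Fintype.card V := by exact_mod_cast Fintype.card_pos
  set N : ℝ := ((Fintype.card V : ℕ) : ℝ) with hNdef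
  set c := ∑ u ∈ L, blockSign P u * x u with hcdef
  rw [le_div_iff₀ hN] at hm
  -- The squared distance, scaled by `N²`, from `x` to `c/N` times the block vector. A vertex whose
  -- sign disagrees with its block costs at least `c² ≥ N/2`.
  have hsum : ∑ u ∈ L, (N * x u - c * blockSign P u) ^ 2 ≤ N ^ 2 * η := by
    have h1 : ∀ u, (N * x u - c * blockSign P u) ^ 2 =
        N ^ 2 * x u ^ 2 - 2 * N * c * (blockSign P u * x u) + c ^ 2 := fun u => by
      linear_combination c ^ 2 * blockSign_sq P u
    simp only [h1, sum_add_distrib, sum_sub_distrib, ← mul_sum, ← hcdef, sum_const, nsmul_eq_mul]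
    have h2 : ∑ u ∈ L, x u ^ 2 ≤ 1 :=
      (sum_le_sum_of_subset_of_nonneg (subset_univ _) fun _ _ _ => sq_nonneg _).trans hx
    have h3 : (#L : ℝ) ≤ N := by rw [hNdef]; exact_mod_cast card_le_univ L
    have h4 : N ^ 2 * ∑ u ∈ L, x u ^ 2 ≤ N ^ 2 * 1 := by gcongr
    have h5 : #L * c ^ 2 ≤ N * c ^ 2 := by gcongr
    nlinarith
  have hcount : ∀ R : Finset V, (∀ u ∈ R, c ^ 2 ≤ (N * x u - c * blockSign P u) ^ 2) →
      (#R : ℝ) ≤ #Lᶜ + 2 * η * N := by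
    intro R hR
    have h1 : #(R ∩ L) * c ^ 2 ≤ N ^ 2 * η := by
      rw [← nsmul_eq_mul]
      refine (card_nsmul_le_sum _ _ _ fun u hu => hR u (mem_of_mem_inter_left hu)).trans
        (le_trans ?_ hsum)
      exact sum_le_sum_of_subset_of_nonneg inter_subset_right fun _ _ _ => sq_nonneg _
    have h2 : (#(R ∩ L) : ℝ) * (N / 2) ≤ N ^ 2 * η := by
      refine le_trans ?_ h1
      gcongr
      nlinarith
    have h3 : (#(R ∩ L) : ℝ) ≤ 2 * η * N := by
      have : N / 2 * #(R ∩ L) ≤ N / 2 * (2 * η * N) := by nlinarith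
      exact le_of_mul_le_mul_left this (by linarith)
    have h4 : (#R : ℝ) ≤ #Lᶜ + #(R ∩ L) := by
      have h5 : R ⊆ Lᶜ ∪ (R ∩ L) := fun u hu => by
        by_cases h : u ∈ L <;> simp [h, hu]
      exact_mod_cast (card_le_card h5).trans (card_union_le _ _)
    linarith
  have hPS : #P = #S := by omega
  -- The cut may fall at either sign. If it falls at a value `≤ 0` outside `S`, all of `P \ S` has
  -- the wrong sign; otherwise `x` is positive on `S` and all of `S \ P` does. The two differences
  -- have equal size.
  rcases em (∀ v ∉ S, x v ≤ 0) with h | h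
  · have h1 : (#P : ℝ) - #(P ∩ S) = #(P \ S) := by
      have := card_sdiff_add_card_inter P S
      rw [← this]; push_cast; ring
    rw [h1]
    refine hcount _ fun u hu => ?_
    rw [mem_sdiff] at hu
    have hxu := h u hu.2
    rw [blockSign, if_pos hu.1]
    nlinarith [mul_nonneg hN.le (neg_nonneg.2 hxu)]
  · push Not at h
    obtain ⟨v, hvS, hv⟩ := h
    have h1 : (#P : ℝ) - #(P ∩ S) = #(S \ P) := by
      have := card_sdiff_add_card_inter S P
      rw [hPS, ← this, inter_comm]; push_cast; ring
    rw [h1]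
    refine hcount _ fun u hu => ?_
    rw [mem_sdiff] at hu
    have hxu := hv.le.trans (hxS u hu.1 v hvS)
    rw [blockSign, if_neg hu.2]
    nlinarith [mul_nonneg hN.le hxu]

end Block

/-! ### The algorithm on a regular graph -/

section Algorithm

variable {n : ℕ}

lemma adjacency_graphOf (ω : Sym2 (Fin (2 * n)) → Prop) (u v : Fin (2 * n)) :
    adjacency (graphOf ω) u v = edge ω u v := by
  classical
  unfold adjacency
  rw [SimpleGraph.adjMatrix_apply]
  simp only [graphOf, SimpleGraph.fromEdgeSet_adj, Set.mem_ofPred_eq, edge, truth]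
  by_cases huv : u = v <;> simp [huv]

lemma zeroOut_adjacency_graphOf (d : ℝ) (ω : Sym2 (Fin (2 * n)) → Prop) :
    zeroOut (adjacency (graphOf ω)) d = Matrix.of (trimmedEdge d ω) := by
  ext u v
  simp only [zeroOut, Matrix.of_apply, adjacency_graphOf, trimmedEdge, lowDegree, mem_filter,
    mem_univ, true_and, ← not_lt]
  by_cases hu : 20 * d < ∑ k, edge ω u k <;> by_cases hv : 20 * d < ∑ k, edge ω v k <;>
    simp [hu, hv]

lemma isHermitian_adjacency (G : SimpleGraph (Fin (2 * n))) : (adjacency G).IsHermitian := by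
  classical
  unfold adjacency
  rw [Matrix.IsHermitian, Matrix.conjTranspose_eq_transpose_of_trivial]
  exact G.transpose_adjMatrix

lemma isBlockProb_edgeProb {a b : ℝ} (hn : 1 ≤ n) (hb : 0 ≤ b) (hab : b ≤ a) (han : a ≤ n)
    (P : Finset (Fin (2 * n))) : IsBlockProb a b P (edgeProb n a b P) := by
  have hn' : (0 : ℝ) < n := by exact_mod_cast hn
  have hprob : ∀ x : ℝ, 0 ≤ x → x ≤ n → (prob (x / n) : ℝ) = x / n := fun x h0 h1 => by
    rw [prob, Set.projIcc_of_mem zero_le_one ⟨by positivity, (div_le_one hn').2 h1⟩]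
  intro u v
  have h1 : (edgeProb n a b P s(u, v) : ℝ) = if (u ∈ P ↔ v ∈ P) then a / n else b / n := by
    rw [← hprob a (hb.trans hab) han, ← hprob b hb (hab.trans han), edgeProb]
    simp only [Sym2.mem_iff, forall_eq_or_imp, forall_eq]
    by_cases hu : u ∈ P <;> by_cases hv : v ∈ P <;> simp [hu, hv]
  rw [h1, Fintype.card_fin]
  push_cast
  by_cases hu : u ∈ P <;> by_cases hv : v ∈ P <;> simp [blockSign, hu, hv] <;> field_simp <;> ring

lemma card_image_perm_lt (τ : Equiv.Perm (Fin (2 * n))) :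
    #((univ.filter fun k : Fin (2 * n) => (k : ℕ) < n).image τ) = n := by
  rw [card_image_of_injective _ τ.injective, Fin.card_filter_val_lt]
  omega

lemma le_of_mem_image_of_notMem {x : Fin (2 * n) → ℝ} {τ : Equiv.Perm (Fin (2 * n))}
    (hτ : ∀ k l, k ≤ l → x (τ l) ≤ x (τ k)) :
    ∀ u ∈ (univ.filter fun k : Fin (2 * n) => (k : ℕ) < n).image τ,
      ∀ v ∉ (univ.filter fun k : Fin (2 * n) => (k : ℕ) < n).image τ, x v ≤ x u := by
  intro u hu v hv
  obtain ⟨k, hk, rfl⟩ := mem_image.1 hu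
  obtain ⟨l, rfl⟩ := τ.surjective v
  simp only [mem_filter, mem_univ, true_and] at hk
  have hl : ¬ (l : ℕ) < n := fun h => hv (mem_image_of_mem _ (by simpa using h))
  exact hτ k l (by rw [Fin.le_def]; omega)

/-- The vector `v₂` of the algorithm is close to the block vector. -/
theorem IsRegular.eigenvector_correlation_le {a b : ℝ} {P : Finset (Fin (2 * n))}
    {p : Sym2 (Fin (2 * n)) → unitInterval} {ω : Sym2 (Fin (2 * n)) → Prop} (hn : 1 ≤ n)
    (hd : 1 ≤ a + b) (hb : 0 ≤ b) (hab : b ≤ a) (han : a ≤ n)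
    (hω : IsRegular (a + b) p P ω) (hp : IsBlockProb a b P p) (hP : #P = n)
    {W : Submodule ℝ (EuclideanSpace ℝ (Fin (2 * n)))}
    (hW : IsTopTwoEigenspace (zeroOut (adjacency (graphOf ω)) (a + b)) W)
    {v : EuclideanSpace ℝ (Fin (2 * n))} (hvW : v ∈ W) (hv1 : ‖v‖ = 1)
    (hv : inner ℝ (W.starProjection (WithLp.toLp 2 fun _ => 1)) v = 0) :
    (a - b) * (1 - (∑ u ∈ lowDegree (a + b) ω, blockSign P u * v u) ^ 2 /
      Fintype.card (Fin (2 * n))) ≤ 108531 * √(a + b) := by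
  have : Nonempty (Fin (2 * n)) := ⟨⟨0, by omega⟩⟩
  have hP2 : 2 * #P = Fintype.card (Fin (2 * n)) := by rw [hP, Fintype.card_fin]
  have hN : (0 : ℝ) < Fintype.card (Fin (2 * n)) := by exact_mod_cast Fintype.card_pos
  have hnorm : ∀ x : EuclideanSpace ℝ (Fin (2 * n)), ‖x‖ = 1 → ∑ u, x u ^ 2 = 1 := fun x hx => by
    rw [← EuclideanSpace.real_norm_sq_eq, hx, one_pow]
  have hnorm' : ∀ x : EuclideanSpace ℝ (Fin (2 * n)), ∑ u, x u ^ 2 = 1 → ‖x‖ = 1 := fun x hx => by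
    rw [← EuclideanSpace.real_norm_sq_eq] at hx
    exact (pow_eq_one_iff_of_nonneg (norm_nonneg _) two_ne_zero).1 hx
  have hv0 : ∑ u, v u = 0 := by
    -- Since `v ∈ W`, being orthogonal to the projection of `1` is being orthogonal to `1` itself.
    rw [Submodule.inner_starProjection_left_eq_right,
      Submodule.starProjection_eq_self_iff.2 hvW] at hv
    simpa [PiLp.inner_apply] using hv
  obtain ⟨w, hw1, hw⟩ := hW.exists_companion (by omega) hvW hv1
  set N : ℝ := ((Fintype.card (Fin (2 * n)) : ℕ) : ℝ) with hNdef
  have hs : 0 < √N := Real.sqrt_pos.2 hN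
  have hss : √N ^ 2 = N := Real.sq_sqrt hN.le
  -- The ideal pair: the normalized constant and block vectors.
  have hmax := hw (WithLp.toLp 2 fun _ => (√N)⁻¹) (WithLp.toLp 2 fun u => (√N)⁻¹ * blockSign P u)
    (hnorm' _ (by
      simp only [inv_pow, hss, sum_const, card_univ, nsmul_eq_mul, ← hNdef]
      field_simp))
    (hnorm' _ (by
      simp only [mul_pow, blockSign_sq, inv_pow, hss, mul_one, sum_const, card_univ, nsmul_eq_mul,
        ← hNdef]
      field_simp))
    (by
      simp only [PiLp.inner_apply, RCLike.inner_apply, conj_trivial, mul_right_comm _ _ (√N)⁻¹]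
      rw [← mul_sum, sum_blockSign hP2, mul_zero])
  rw [zeroOut_adjacency_graphOf] at hmax
  refine hω.correlation_le hd hb hab hp hP2 ?_ (hnorm w hw1) (hnorm v hv1) hv0 ?_
  · rw [Fintype.card_fin]; push_cast; linarith
  refine le_trans (le_of_eq ?_) hmax
  simp only [quadForm, Matrix.of_apply, ← sum_add_distrib]
  rw [sum_div]
  refine sum_congr rfl fun u _ => ?_
  rw [sum_div]
  refine sum_congr rfl fun u' _ => ?_
  rw [← hNdef]
  field_simp
  rw [hss]

/-- The separation gives `10^6 √d ≤ γ (a - b)`, so the defect `108531 √d / (a - b)` is below `η =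
γ/8`. The misplaced vertices number at most `γn/2` (trimmed) plus `2η · 2n = γn/2`. -/
theorem IsRegular.spectralPartitionSucceeds {a b γ : ℝ} {P : Finset (Fin (2 * n))}
    {p : Sym2 (Fin (2 * n)) → unitInterval} {ω : Sym2 (Fin (2 * n)) → Prop} (hn : 1 ≤ n)
    (hb : 1 < b) (hab : b < a) (hγ : 0 < γ)
    (hsep : 10 ^ 12 * (1 / γ ^ 2) ≤ (a - b) ^ 2 / (a + b)) (han : a ≤ n)
    (hω : IsRegular (a + b) p P ω) (hp : IsBlockProb a b P p) (hP : #P = n) :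
    SpectralPartitionSucceeds n (a + b) γ P (graphOf ω) := by
  refine ⟨exists_isSpectralPartitionOutput hn (isHermitian_adjacency _) _, ?_⟩
  rintro S T ⟨W, v₁, v, τ, hW, rfl, ⟨hvW, hv1, hv⟩, hτ, rfl, rfl⟩
  have hn' : (0 : ℝ) < n := by exact_mod_cast hn
  rcases le_or_gt 1 γ with hγ1 | hγ1
  · left
    have : (1 - γ) * n ≤ 0 := mul_nonpos_of_nonpos_of_nonneg (by linarith) hn'.le
    exact ⟨this.trans (by positivity), this.trans (by positivity)⟩
  have hcorr := hω.eigenvector_correlation_le hn (by linarith) (by linarith) hab.le han hp hP hW hvW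
    hv1 hv
  set S := (univ.filter fun k : Fin (2 * n) => (k : ℕ) < n).image τ with hSdef
  have : Nonempty (Fin (2 * n)) := ⟨⟨0, by omega⟩⟩
  have hP2 : 2 * #P = Fintype.card (Fin (2 * n)) := by rw [hP, Fintype.card_fin]
  have hS : #S = n := card_image_perm_lt τ
  have hS2 : 2 * #S = Fintype.card (Fin (2 * n)) := by rw [hS, Fintype.card_fin]
  have hbad := (hω.highDegree_le (by linarith) hp hP2).1
  have hcardN : ((Fintype.card (Fin (2 * n)) : ℕ) : ℝ) = 2 * n := by
    rw [Fintype.card_fin]; push_cast; rfl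
  set d := a + b with hddef
  set L := lowDegree d ω with hL
  set c := ∑ u ∈ L, blockSign P u * v u with hc
  have hd : 0 < d := by linarith
  have hs : 0 < √d := Real.sqrt_pos.2 hd
  have hss : √d ^ 2 = d := Real.sq_sqrt hd.le
  have hab' : 0 < a - b := by linarith
  have hsep1 : 10 ^ 6 * √d ≤ γ * (a - b) := by
    rw [mul_one_div, div_le_div_iff₀ (by positivity) hd] at hsep
    refine le_of_sq_le_sq ?_ (by positivity)
    rw [mul_pow, hss, mul_pow]
    linarith
  have hsep2 : 10 ^ 6 ≤ γ * √d := by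
    have h1 : a - b ≤ √d * √d := by rw [← sq, hss]; linarith
    have h2 : √d * 10 ^ 6 ≤ √d * (γ * √d) := by
      calc √d * 10 ^ 6 = 10 ^ 6 * √d := mul_comm _ _
        _ ≤ γ * (a - b) := hsep1
        _ ≤ γ * (√d * √d) := by gcongr
        _ = √d * (γ * √d) := by ring
    exact le_of_mul_le_mul_left h2 hs
  have hη : 1 - γ / 8 ≤ c ^ 2 / Fintype.card (Fin (2 * n)) := by
    have h1 : (a - b) * (1 - c ^ 2 / Fintype.card (Fin (2 * n))) ≤ (a - b) * (γ / 8) := by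
      linarith
    linarith [le_of_mul_le_mul_left h1 hab']
  have hLc : (#Lᶜ : ℝ) ≤ γ * n / 2 := by
    rw [hcardN] at hbad
    have h1 : √d * (3 * #Lᶜ) ≤ √d * (γ * n) := by
      calc √d * (3 * #Lᶜ) = 3 * √d * #Lᶜ := by ring
        _ ≤ 2 * n := hbad
        _ ≤ (γ * √d) * n := by gcongr; linarith
        _ = √d * (γ * n) := by ring
    have h2 := le_of_mul_le_mul_left h1 hs
    have : 0 ≤ γ * n := by positivity
    linarith
  have hvsq : ∑ u, v u ^ 2 ≤ 1 := by
    rw [← EuclideanSpace.real_norm_sq_eq, hv1, one_pow]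
  have hxS := le_of_mem_image_of_notMem hτ
  rw [← hSdef] at hxS
  have hcpos : c ≠ 0 := by
    intro h
    rw [h] at hη
    norm_num at hη
    linarith
  have hinter : ∀ Q : Finset (Fin (2 * n)), #Q = n → #(Qᶜ ∩ Sᶜ) = #(Q ∩ S) := by
    intro Q hQ
    have h1 := card_union_add_card_inter Q S
    have h2 := card_compl (Q ∪ S)
    have h3 := card_le_univ (Q ∪ S)
    rw [Fintype.card_fin] at h2 h3
    rw [← compl_union]
    omega
  -- The sign of `v₂` is arbitrary: a negative correlation with `P` is a positive one with `Pᶜ`, and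
  -- the names of the blocks are exchanged.
  rcases lt_or_gt_of_ne hcpos with hneg | hpos
  · right
    have hPc : #Pᶜ = n := by
      rw [card_compl, Fintype.card_fin, hP]; omega
    have hcc : ∑ u ∈ L, blockSign Pᶜ u * v u = -c := by
      simp only [blockSign_compl, neg_mul, sum_neg_distrib, hc]
    have h := card_sub_card_inter_le (P := Pᶜ) (L := L) (x := v) (η := γ / 8)
      (by rw [hPc, Fintype.card_fin]) hS2 hvsq hxS (by rw [hcc]; linarith) (by linarith)
      (by rw [hcc, neg_sq]; exact hη)
    rw [hPc, hcardN] at h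
    have h2 : #(P ∩ Sᶜ) = #(Pᶜ ∩ S) := by
      rw [← hinter Pᶜ hPc, compl_compl]
    rw [h2]
    constructor <;> linarith
  · left
    have h := card_sub_card_inter_le (P := P) (L := L) (x := v) (η := γ / 8)
      hP2 hS2 hvsq hxS hpos (by linarith) hη
    rw [hP, hcardN] at h
    rw [hinter P hP]
    constructor <;> linarith

theorem le_measure_spectralPartitionSucceeds {a b γ : ℝ} (hn : 1 ≤ n) (hb : 1 < b) (hab : b < a)
    (hγ : 0 < γ) (hsep : 10 ^ 12 * (1 / γ ^ 2) ≤ (a - b) ^ 2 / (a + b)) (han : a ≤ n)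
    {P : Finset (Fin (2 * n))} (hP : #P = n) :
    1 - 5 / (2 * n) ≤ (blockModel n a b P).real
      {G | SpectralPartitionSucceeds n (a + b) γ P G} := by
  have : Nonempty (Fin (2 * n)) := ⟨⟨0, by omega⟩⟩
  have hp := isBlockProb_edgeProb hn (by linarith) hab.le han P
  have hbad := measure_not_isRegular_le (d := a + b) (by linarith) (hp.le (by linarith) hab.le) P
  rw [Fintype.card_fin] at hbad
  push_cast at hbad
  set A : Set (Sym2 (Fin (2 * n)) → Prop) :=
    {ω | SpectralPartitionSucceeds n (a + b) γ P (graphOf ω)}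
  set R : Set (Sym2 (Fin (2 * n)) → Prop) := {ω | ¬ IsRegular (a + b) (edgeProb n a b P) P ω}
  have hcover : (Set.univ : Set (Sym2 (Fin (2 * n)) → Prop)) ⊆ A ∪ R := fun ω _ => by
    by_cases h : IsRegular (a + b) (edgeProb n a b P) P ω
    · exact Or.inl (h.spectralPartitionSucceeds hn hb hab hγ hsep han hp hP)
    · exact Or.inr h
  have h1 : 1 ≤ (indepLaw (edgeProb n a b P)).real A + (indepLaw (edgeProb n a b P)).real R := by
    refine le_trans ?_ (measureReal_union_le A R)
    rw [← probReal_univ (μ := indepLaw (edgeProb n a b P))]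
    exact measureReal_mono hcover
  -- This inequality for a pushforward holds for every set, so measurability of success is not
  -- needed.
  have h2 : (indepLaw (edgeProb n a b P)).real A ≤ (blockModel n a b P).real
      {G | SpectralPartitionSucceeds n (a + b) γ P G} :=
    ENNReal.toReal_mono (measure_ne_top _ _)
      (Measure.le_map_apply (measurable_graphOf n).aemeasurable _)
  linarith

end Algorithm

end SpectralSBM

end

theorem theorem2p1 :
    ∃ C₀ C₁ : ℝ, 0 < C₀ ∧ 0 < C₁ ∧
      ∀ a b γ : ℝ, C₀ < b → b < a → 0 < γ →
        C₁ * (1 / γ ^ 2) ≤ (a - b) ^ 2 / (a + b) →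
        ∀ V₁ : (n : ℕ) → Finset (Fin (2 * n)), (∀ n, (V₁ n).card = n) →
          Filter.Tendsto
            (fun n : ℕ => (SpectralSBM.blockModel n a b (V₁ n)).real
              {G | SpectralSBM.SpectralPartitionSucceeds n (a + b) γ (V₁ n) G})
            Filter.atTop (nhds 1) := by
  refine ⟨1, 10 ^ 12, one_pos, by norm_num, fun a b γ hb hab hγ hsep V₁ hV₁ => ?_⟩
  have hlim : Filter.Tendsto (fun n : ℕ => 1 - (5 / 2 : ℝ) / n) Filter.atTop (nhds 1) := by
    simpa using (tendsto_const_nhds (x := (1 : ℝ))).sub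
      (tendsto_const_div_atTop_nhds_zero_nat (5 / 2 : ℝ))
  refine tendsto_of_tendsto_of_tendsto_of_le_of_le' hlim tendsto_const_nhds ?_ ?_
  · filter_upwards [Filter.eventually_ge_atTop 1, Filter.eventually_ge_atTop ⌈a⌉₊] with n hn han
    rw [div_div]
    exact SpectralSBM.le_measure_spectralPartitionSucceeds hn hb hab hγ hsep
      ((Nat.le_ceil a).trans (by exact_mod_cast han)) (hV₁ n)
  · exact Filter.Eventually.of_forall fun n => MeasureTheory.measureReal_le_one
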